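/- Let $D\ge 1$ and $\ell\ge 2$ be integers and, for $n\ge 0$, let $\mathcal F_n$ be the family of $\ell$-adic cubes $\prod_{i=1}^D[k_i/\ell^n,(k_i+1)/\ell^n)$, $0\le k_i<\ell^n$. Let the cubes be coded by words over the alphabet $\{0,\dots,\ell^D-1\}$, that is, for every $n$ the map $\varepsilon_1\cdots\varepsilon_n\mapsto I_{\varepsilon_1\cdots\varepsilon_n}$ is a bijection from the words of length $n$ onto $\mathcal F_n$, and $I_{\varepsilon_1\cdots\varepsilon_{n+1}}\subset I_{\varepsilon_1\cdots\varepsilon_n}$. For $I=I_{\varepsilon_1\cdots\varepsilon_n}$ and $J=I_{\eta_1\cdots\eta_p}$ write $IJ=I_{\varepsilon_1\cdots\varepsilon_n\eta_1\cdots\eta_p}$. Let $m$ be a quasi-Bernoulli measure on $[0,1)^D$, i.e. a Borel probability measure on $\mathbb R^D$ with $m([0,1)^D)=1$ for which there is a constant $C\ge 1$ such that $$\frac1C\,m(I)\,m(J)\le m(IJ)\le C\,m(I)\,m(J)\qquad\text{for all } I,J\in\bigcup_n\mathcal F_n .$$ Suppose that its $L^q$-spectrum $$\tau(q)=\limsup_{n\to\infty}\frac1{n\log\ell}\log\Big(\sum_{I\in\mathcal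 F_n,\ m(I)>0}m(I)^q\Big),\qquad q\in\mathbb R,$$ is real analytic on $\mathbb R$. Denote by $\dim$ the Hausdorff dimension of sets, by $\operatorname{supp}(m)$ the closed support of $m$ in $\mathbb R^D$, by $\mathcal H^s$ the $s$-dimensional Hausdorff measure, and by $\widehat{\mathcal P}^s$ the $s$-dimensional packing measure $\widehat{\mathcal P}^s(A)=\inf\{\sum_j\mathcal P^s(A_j):\ A\subset\bigcup_{j\in\mathbb N}A_j\}$, where $\mathcal P^s(A)=\lim_{\varepsilon\to0}\sup\sum_i(2r_i)^s$, the supremum being over the families of pairwise disjoint closed balls with centres in $A$ and radii $r_i\in(0,\varepsilon]$. Then $m$ is unidimensional, i.e. the lower dimension $\inf\{\dim A: A \text{ Borel},\ m(A)>0\}$ and the upper dimension $\inf\{\dim A: A\text{ Borel},\ m(A)=1\}$ have a common value $d=\dim(m)$, and with $\delta=\dim(\operatorname{supp}(m))$ one of the following two (mutually exclusive) cases occurs: (i) $d=\delta$ and $m$ is strongly equivalent to $\mathcal H^\delta$ on $\operatorname{supp}(m)$: there is a constant $C\ge1$ such that $\frac1C\mathcal H^\delta(A\cap\operatorname{supp}(m))\le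 m(A)\le C\,\mathcal H^\delta(A\cap\operatorname{supp}(m))$ for every Borel set $A$; (ii) $d<\delta$, and $m$ is singular with respect to $\mathcal H^d$ but absolutely continuous with respect to $\widehat{\mathcal P}^d$. -/

import Mathlib

open MeasureTheory Measure Set Filter
open scoped ENNReal NNReal Topology

noncomputable section

namespace QB

/-- `ℝ^D` with its Euclidean metric and Borel `σ`-algebra. -/
abbrev E (D : ℕ) : Type := EuclideanSpace ℝ (Fin D)

/-! ### Packing measures -/

section Packing

variable {X : Type*} [MetricSpace X]

/-- A finite family of pairwise disjoint closed balls (coded as pairs centre/radius) with centres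
in `A` and radii in `(0, ε]`. -/
def IsPacking (A : Set X) (ε : ℝ) (P : Finset (X × ℝ)) : Prop :=
  (∀ p ∈ P, p.1 ∈ A ∧ 0 < p.2 ∧ p.2 ≤ ε) ∧
    (P : Set (X × ℝ)).PairwiseDisjoint (fun p => Metric.closedBall p.1 p.2)

/-- Supremum of `∑ (2 rᵢ)^s` over the packings of `A` by balls of radius `rᵢ ≤ ε`. Passing from
finite to countable packings would not change the supremum. -/
def packingPreAt (s ε : ℝ) (A : Set X) : ℝ≥0∞ :=
  ⨆ (P : Finset (X × ℝ)) (_ : IsPacking A ε P), ∑ p ∈ P, ENNReal.ofReal ((2 * p.2) ^ s)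

/-- The packing pre-measure: the limit (infimum) of `packingPreAt s ε A` as `ε ↓ 0`. -/
def packingPre (s : ℝ) (A : Set X) : ℝ≥0∞ :=
  ⨅ (ε : ℝ) (_ : 0 < ε), packingPreAt s ε A

lemma packingPreAt_mono (s : ℝ) {ε ε' : ℝ} (h : ε ≤ ε') {A B : Set X} (hAB : A ⊆ B) :
    packingPreAt s ε A ≤ packingPreAt s ε' B := by
  refine iSup₂_le fun P hP => ?_
  refine le_iSup₂_of_le P ⟨fun p hp => ?_, hP.2⟩ le_rfl
  obtain ⟨h1, h2, h3⟩ := hP.1 p hp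
  exact ⟨hAB h1, h2, h3.trans h⟩

lemma packingPre_mono (s : ℝ) {A B : Set X} (hAB : A ⊆ B) :
    packingPre s A ≤ packingPre s B :=
  iInf₂_mono fun _ _ => packingPreAt_mono s le_rfl hAB

lemma packingPre_empty (s : ℝ) : packingPre s (∅ : Set X) = 0 := by
  refine le_antisymm ((iInf₂_le (1 : ℝ) one_pos).trans ?_) bot_le
  refine iSup₂_le fun P hP => ?_
  have : P = ∅ := Finset.eq_empty_of_forall_notMem fun p hp => (hP.1 p hp).1
  simp [this]

lemma packingPre_add_le (s : ℝ) {A B : Set X} (h : Metric.AreSeparated A B) :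
    packingPre s A + packingPre s B ≤ packingPre s (A ∪ B) := by
  classical
  obtain ⟨r, hr0, hr⟩ := h
  obtain ⟨ρ, hρ0, hρ⟩ : ∃ ρ : ℝ, 0 < ρ ∧ ENNReal.ofReal (2 * ρ) < r := by
    obtain ⟨c, hc0, hc⟩ := ENNReal.lt_iff_exists_nnreal_btwn.1 (pos_iff_ne_zero.2 hr0)
    refine ⟨c / 2, by have : (0 : ℝ) < c := by exact_mod_cast hc0
                      positivity, ?_⟩
    rw [mul_div_cancel₀ (c : ℝ) two_ne_zero, ENNReal.ofReal_coe_nnreal]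
    exact hc
  refine le_iInf₂ fun ε hε => ?_
  have hm : 0 < min ε ρ := lt_min hε hρ0
  refine (add_le_add (iInf₂_le _ hm) (iInf₂_le _ hm)).trans ?_
  refine le_trans ?_ (packingPreAt_mono s (min_le_left ε ρ) subset_rfl)
  unfold packingPreAt
  refine ENNReal.biSup_add_biSup_le' ⟨∅, by simp [IsPacking]⟩ ⟨∅, by simp [IsPacking]⟩ ?_
  intro P hP Q hQ
  have hfar : ∀ p ∈ P, ∀ q ∈ Q,
      Disjoint (Metric.closedBall p.1 p.2) (Metric.closedBall q.1 q.2) := by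
    intro p hp q hq
    obtain ⟨hp1, hp2, hp3⟩ := hP.1 p hp
    obtain ⟨hq1, hq2, hq3⟩ := hQ.1 q hq
    apply Metric.closedBall_disjoint_closedBall
    by_contra! hle
    have h1 := hr _ hp1 _ hq1
    rw [edist_dist] at h1
    have h2 : dist p.1 q.1 ≤ 2 * ρ := by
      have := min_le_right ε ρ
      linarith
    exact absurd (h1.trans (ENNReal.ofReal_le_ofReal h2)) (not_le.2 hρ)
  have hdisj : Disjoint P Q := by
    rw [Finset.disjoint_left]
    intro p hp hq
    have hne : (Metric.closedBall p.1 p.2).Nonempty :=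
      Metric.nonempty_closedBall.2 (hP.1 p hp).2.1.le
    exact hne.ne_empty (disjoint_self.1 (hfar p hp p hq))
  refine le_iSup₂_of_le (P ∪ Q) ⟨?_, ?_⟩ (Finset.sum_union hdisj).ge
  · intro p hp
    rcases Finset.mem_union.1 hp with hp | hp
    · exact ⟨Or.inl (hP.1 p hp).1, (hP.1 p hp).2⟩
    · exact ⟨Or.inr (hQ.1 p hp).1, (hQ.1 p hp).2⟩
  · rw [Finset.coe_union, pairwiseDisjoint_union]
    exact ⟨hP.2, hQ.2, fun p hp q hq _ => hfar p hp q hq⟩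

/-- The packing outer measure: the infimum of `∑ᵢ packingPre s (Aᵢ)` over countable covers. -/
def packingOuter (s : ℝ) : OuterMeasure X :=
  OuterMeasure.ofFunction (packingPre s) (packingPre_empty s)

lemma packingOuter_isMetric (s : ℝ) : (packingOuter s : OuterMeasure X).IsMetric := by
  intro A B h
  refine le_antisymm (measure_union_le A B) ?_
  unfold packingOuter
  rw [OuterMeasure.ofFunction_apply _ _ (A ∪ B)]
  refine le_iInf₂ fun t ht => ?_
  have hA : A ⊆ ⋃ i, t i ∩ A := by
    rw [← iUnion_inter]
    exact subset_inter (subset_union_left.trans ht) subset_rfl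
  have hB : B ⊆ ⋃ i, t i ∩ B := by
    rw [← iUnion_inter]
    exact subset_inter (subset_union_right.trans ht) subset_rfl
  rw [OuterMeasure.ofFunction_apply, OuterMeasure.ofFunction_apply]
  refine (add_le_add (iInf₂_le (fun i => t i ∩ A) hA) (iInf₂_le (fun i => t i ∩ B) hB)).trans ?_
  rw [← ENNReal.tsum_add]
  refine ENNReal.tsum_le_tsum fun i => ?_
  refine (packingPre_add_le s (h.mono inter_subset_right inter_subset_right)).trans ?_
  exact packingPre_mono s (union_subset inter_subset_left inter_subset_left)

/-- The `s`-dimensional packing measure, as a Borel measure. -/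
def packingMeasure [MeasurableSpace X] [BorelSpace X] (s : ℝ) : Measure X :=
  (packingOuter s).toMeasure
    ((BorelSpace.measurable_eq (α := X)).trans_le (packingOuter_isMetric s).borel_le_caratheodory)

end Packing

/-! ### Lower and upper Hausdorff dimension of a measure -/

/-- `dim_*(m) = inf {dim A ; m(A) > 0}`. -/
def lowerDim {D : ℕ} (m : Measure (E D)) : ℝ≥0∞ :=
  ⨅ (A : Set (E D)) (_ : MeasurableSet A) (_ : 0 < m A), dimH A

/-- `dim^*(m) = inf {dim A ; m(A) = 1}`. -/
def upperDim {D : ℕ} (m : Measure (E D)) : ℝ≥0∞ :=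
  ⨅ (A : Set (E D)) (_ : MeasurableSet A) (_ : m A = 1), dimH A

/-- The measure `m` is unidimensional with dimension `d`. -/
def HasDim {D : ℕ} (m : Measure (E D)) (d : ℝ≥0∞) : Prop :=
  lowerDim m = d ∧ upperDim m = d

/-- Two measures are strongly equivalent if each is bounded by a constant multiple of the other
on Borel sets. -/
def StronglyEquivalent {D : ℕ} (μ ν : Measure (E D)) : Prop :=
  ∃ C : ℝ≥0, 1 ≤ C ∧ ∀ A : Set (E D), MeasurableSet A →
    (C : ℝ≥0∞)⁻¹ * ν A ≤ μ A ∧ μ A ≤ C * ν A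

/-! ### `ℓ`-adic cubes and quasi-Bernoulli measures -/

/-- The unit cube `[0,1)^D`. -/
def unitCube (D : ℕ) : Set (E D) := {x | ∀ i, 0 ≤ x i ∧ x i < 1}

/-- The `ℓ`-adic cube `∏ i, [k i / ℓ^n, (k i + 1) / ℓ^n)` of generation `n`. -/
def cube {D : ℕ} (ℓ n : ℕ) (k : Fin D → Fin (ℓ ^ n)) : Set (E D) :=
  {x | ∀ i, ((k i : ℕ) : ℝ) / (ℓ : ℝ) ^ n ≤ x i ∧ x i < (((k i : ℕ) : ℝ) + 1) / (ℓ : ℝ) ^ n}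

/-- The family of all `ℓ`-adic cubes of generation `n` in `[0,1)^D`. -/
def cubes (D ℓ n : ℕ) : Set (Set (E D)) := range (cube (D := D) ℓ n)

/-- A coding of the `ℓ`-adic cubes by words over the alphabet `{0, …, ℓ^D - 1}`: words of length
`n` correspond bijectively to cubes of generation `n`, and extending the word shrinks the cube. -/
structure IsCoding {D ℓ : ℕ} (I : List (Fin (ℓ ^ D)) → Set (E D)) : Prop where
  bijOn : ∀ n : ℕ, BijOn I {w | w.length = n} (cubes D ℓ n)
  nested : ∀ (w : List (Fin (ℓ ^ D))) (a : Fin (ℓ ^ D)), I (w ++ [a]) ⊆ I w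

/-- A quasi-Bernoulli probability measure on `[0,1)^D` with respect to the coding `I`; the cube
obtained by concatenating `I u` and `I v` is `I (u ++ v)`. -/
structure IsQuasiBernoulli {D ℓ : ℕ} (I : List (Fin (ℓ ^ D)) → Set (E D))
    (m : Measure (E D)) : Prop where
  isProbabilityMeasure : IsProbabilityMeasure m
  measure_unitCube : m (unitCube D) = 1
  quasi : ∃ C : ℝ, 1 ≤ C ∧ ∀ u v : List (Fin (ℓ ^ D)),
    1 / C * (m.real (I u) * m.real (I v)) ≤ m.real (I (u ++ v)) ∧
      m.real (I (u ++ v)) ≤ C * (m.real (I u) * m.real (I v))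

/-- `∑ m(I)^q` over the cubes `I` of generation `n` that are charged by `m`. -/
def partitionSum {D : ℕ} (ℓ : ℕ) (m : Measure (E D)) (n : ℕ) (q : ℝ) : ℝ :=
  ∑ k : Fin D → Fin (ℓ ^ n), if m.real (cube ℓ n k) = 0 then 0 else m.real (cube ℓ n k) ^ q

/-- The `L^q`-spectrum `τ(q) = limsup_n (1 / (n log ℓ)) log ∑ m(I)^q`. -/
def lqSpectrum {D : ℕ} (ℓ : ℕ) (m : Measure (E D)) (q : ℝ) : ℝ :=
  limsup (fun n : ℕ => 1 / ((n : ℝ) * Real.log ℓ) * Real.log (partitionSum ℓ m n q)) atTop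

end QB

end

noncomputable section

namespace QB

/-! ### Almost additive sequences -/

/-! Write `p w = m (I w)`. Quasi-multiplicativity makes `log ∑ p w ^ q` almost additive in the
generation, so it equals `n τ(q) log ℓ` up to `|q| log C`, uniformly in `n` (`IsSpectrum`). Hence
`τ` is convex, `τ(1) = 0`, and there are exactly `ℓ ^ (n τ(0))` charged cubes of generation `n`. Put
`d = -τ'(1)`. The number `τ(0)` is the dimension of the support: the charged cubes cover it, and the
uniform Bernoulli measure on charged letters lives on it. Chebyshev bounds with exponents near `1`,
together with Borel-Cantelli, show that almost every point lies in cubes of mass `ℓ ^ (-n (d +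
o(1)))`, so `m` has dimension `d` (`IsSpectrum.hasDim`).

The tangent at `1` gives `d ≤ τ(0)`. In case of equality, convexity and analyticity make `τ` affine;
letting `q → ±∞` forces `p w` to be comparable to `ℓ ^ (-n δ)` on charged words, and `m` is
equivalent to Hausdorff measure on its support.

If `d < τ(0)`, then `φ(t) = τ(1 + t) + d t` is analytic, nonnegative and not identically zero, hence
`φ(2t) ≤ M φ(t)` near `0`. At a generation `n` of order `1 / φ(t)`, the variable `(p w ℓ ^ (n d)) ^
t` has a large mean and a bounded second moment, so it exceeds `2` with probability bounded below
(`exists_le_sum_filter`). Taking `t → 0` from either side produces arbitrarily large and arbitrarily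
small ratios `p w / ℓ ^ (-n d)`. Quasi-multiplicativity reproduces this inside every cube, and a set
filling a fixed proportion of each cube has full measure (`IsCoding.measure_compl_eq_zero`). Large
ratios yield singularity to Hausdorff measure; small ones, once transferred from cubes to balls,
yield absolute continuity with respect to packing measure. -/

lemma exists_tendsto_of_almost_additive {a : ℕ → ℝ} {B : ℝ}
    (h : ∀ n k, |a (n + k) - a n - a k| ≤ B) :
    ∃ r, Tendsto (fun n => a n / n) atTop (𝓝 r) ∧ ∀ n : ℕ, |a n - n * r| ≤ B := by
  have hB : 0 ≤ B := (abs_nonneg _).trans (h 0 0)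
  have hlin : ∀ n : ℕ, |a n| ≤ B + n * (|a 1| + B) := by
    intro n
    induction n with
    | zero => have := h 0 0; simp only [add_zero, sub_self, zero_sub, abs_neg] at this; simpa
    | succ n ih =>
      have h1 := abs_le.1 (h n 1)
      have h2 := abs_le.1 ih
      have h3 := neg_abs_le (a 1)
      have h4 := le_abs_self (a 1)
      push_cast
      rw [abs_le]
      constructor <;> nlinarith
  have hdiv : ∀ n : ℕ, |a n / n| ≤ 2 * B + |a 1| := by
    intro n
    rcases Nat.eq_zero_or_pos n with rfl | hn
    · simp; positivity
    have hn' : (1 : ℝ) ≤ n := by exact_mod_cast hn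
    rw [abs_div, Nat.abs_cast, div_le_iff₀ (by positivity)]
    nlinarith [hlin n, abs_nonneg (a 1)]
  have hBn : ∀ n : ℕ, 0 ≤ B / n ∧ B / n ≤ B := fun n => by
    refine ⟨by positivity, ?_⟩
    rcases Nat.eq_zero_or_pos n with rfl | hn
    · simpa
    · exact div_le_self hB (by exact_mod_cast hn)
  -- Fekete's lemma is applied to both `a + B` and `-a + B`. Each limit is an infimum, and together
  -- they bound `a n - n r` by `B` from both sides.
  have hs1 : Subadditive (fun n => a n + B) := fun m n => by
    have := (abs_le.1 (h m n)).2
    linarith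
  have hs2 : Subadditive (fun n => -a n + B) := fun m n => by
    have := (abs_le.1 (h m n)).1
    linarith
  have hb1 : BddBelow (range fun n : ℕ => (a n + B) / n) := by
    refine ⟨-(2 * B + |a 1|), ?_⟩
    rintro _ ⟨n, rfl⟩
    have h1 := (abs_le.1 (hdiv n)).1
    have h2 := (hBn n).1
    simp only [add_div]
    linarith
  have hb2 : BddBelow (range fun n : ℕ => (-a n + B) / n) := by
    refine ⟨-(2 * B + |a 1|), ?_⟩
    rintro _ ⟨n, rfl⟩
    have h1 := (abs_le.1 (hdiv n)).2
    have h2 := (hBn n).1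
    simp only [add_div, neg_div]
    linarith
  have ht0 : Tendsto (fun n : ℕ => B / (n : ℝ)) atTop (𝓝 0) :=
    tendsto_const_div_atTop_nhds_zero_nat B
  have ht1 : Tendsto (fun n => a n / n) atTop (𝓝 hs1.lim) := by
    have := (hs1.tendsto_lim hb1).sub ht0
    rw [sub_zero] at this
    refine this.congr fun n => ?_
    rw [add_div]; ring
  have ht2 : Tendsto (fun n => a n / n) atTop (𝓝 (-hs2.lim)) := by
    have := (ht0.sub (hs2.tendsto_lim hb2))
    rw [zero_sub] at this
    refine this.congr fun n => ?_
    rw [add_div]; ring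
  have heq := tendsto_nhds_unique ht1 ht2
  refine ⟨hs1.lim, ht1, fun n => ?_⟩
  rcases Nat.eq_zero_or_pos n with rfl | hn
  · have := h 0 0; simp only [add_zero, sub_self, zero_sub, abs_neg] at this; simpa
  have hn' : (0 : ℝ) < n := by exact_mod_cast hn
  have h1 := hs1.lim_le_div hb1 hn.ne'
  have h2 := hs2.lim_le_div hb2 hn.ne'
  rw [le_div_iff₀ hn'] at h1 h2
  rw [abs_le]
  constructor <;> nlinarith

/-! ### Quasi-multiplicative functions on words -/

section Words

variable {α : Type*} [Finite α]

/-- The words of length `n`. -/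
def words (α : Type*) [Finite α] (n : ℕ) : Finset (List α) := (List.finite_length_eq α n).toFinset

@[simp] lemma mem_words {n : ℕ} {w : List α} : w ∈ words α n ↔ w.length = n := by
  simp [words]

lemma sum_words_add (f : List α → ℝ) (n k : ℕ) :
    ∑ w ∈ words α (n + k), f w = ∑ u ∈ words α n, ∑ v ∈ words α k, f (u ++ v) := by
  rw [← Finset.sum_product']
  symm
  refine Finset.sum_bij (fun x _ => x.1 ++ x.2) ?_ ?_ ?_ ?_
  · rintro ⟨u, v⟩ h
    simp only [Finset.mem_product, mem_words] at h
    simp [h.1, h.2]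
  · rintro ⟨u, v⟩ h ⟨u', v'⟩ h' heq
    simp only [Finset.mem_product, mem_words] at h h'
    obtain ⟨h1, h2⟩ := List.append_inj heq (h.1.trans h'.1.symm)
    exact Prod.ext h1 h2
  · intro w hw
    rw [mem_words] at hw
    refine ⟨(w.take n, w.drop n), ?_, List.take_append_drop n w⟩
    simp [hw]
  · intro _ _; rfl

/-- A nonnegative function on words that defines a probability on the words of each length, and
that is multiplicative up to the constant `C`. -/
structure IsQuasiMultiplicative (p : List α → ℝ) (C : ℝ) : Prop where
  one_le : 1 ≤ C
  nonneg : ∀ w, 0 ≤ p w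
  nil : p [] = 1
  sum_append : ∀ (u : List α) (n : ℕ), ∑ v ∈ words α n, p (u ++ v) = p u
  lower : ∀ u v, 1 / C * (p u * p v) ≤ p (u ++ v)
  upper : ∀ u v, p (u ++ v) ≤ C * (p u * p v)

/-- The sum of `p w ^ q` over the words `w` of length `n` charged by `p`. -/
def powSum (p : List α → ℝ) (n : ℕ) (q : ℝ) : ℝ :=
  ∑ w ∈ words α n, if p w = 0 then 0 else p w ^ q

lemma rpow_bounds {x y C q : ℝ} (hx : 0 < x) (hy : 0 < y) (hC : 1 ≤ C)
    (h1 : 1 / C * y ≤ x) (h2 : x ≤ C * y) :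
    C ^ (-|q|) * y ^ q ≤ x ^ q ∧ x ^ q ≤ C ^ |q| * y ^ q := by
  have hC0 : 0 < C := by linarith
  have l1 : Real.log y - Real.log C ≤ Real.log x := by
    have := Real.log_le_log (by positivity) h1
    rw [Real.log_mul (by positivity) hy.ne', one_div, Real.log_inv] at this
    linarith
  have l2 : Real.log x ≤ Real.log C + Real.log y := by
    have := Real.log_le_log hx h2
    rwa [Real.log_mul (by positivity) hy.ne'] at this
  have key : |q * (Real.log x - Real.log y)| ≤ |q| * Real.log C := by
    rw [abs_mul]
    refine mul_le_mul_of_nonneg_left ?_ (abs_nonneg q)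
    rw [abs_le]; constructor <;> linarith
  have key' := abs_le.1 key
  rw [Real.rpow_def_of_pos hx, Real.rpow_def_of_pos hy, Real.rpow_def_of_pos hC0,
    Real.rpow_def_of_pos hC0, ← Real.exp_add, ← Real.exp_add]
  constructor <;> apply Real.exp_le_exp.2 <;> nlinarith

namespace IsQuasiMultiplicative

variable {p : List α → ℝ} {C : ℝ} (hp : IsQuasiMultiplicative p C)
include hp

lemma C_pos : 0 < C := zero_lt_one.trans_le hp.one_le

lemma sum_words (n : ℕ) : ∑ v ∈ words α n, p v = 1 := by
  simpa [hp.nil] using hp.sum_append [] n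

lemma le_one (w : List α) : p w ≤ 1 := by
  rw [← hp.sum_words w.length]
  exact Finset.single_le_sum (fun v _ => hp.nonneg v) (mem_words.2 rfl)

/-- Consequence: the charged words form the full shift over the charged letters. -/
lemma append_eq_zero (u v : List α) : p (u ++ v) = 0 ↔ p u = 0 ∨ p v = 0 := by
  constructor
  · intro h
    have h1 := hp.lower u v
    rw [h] at h1
    have h2 : 0 < 1 / C := by have := hp.C_pos; positivity
    have h3 : p u * p v ≤ 0 := by
      by_contra! h4
      exact absurd h1 (not_le.2 (mul_pos h2 h4))
    exact mul_eq_zero.1 (le_antisymm h3 (mul_nonneg (hp.nonneg u) (hp.nonneg v)))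
  · intro h
    have h1 := hp.upper u v
    rw [mul_eq_zero.2 h, mul_zero] at h1
    exact le_antisymm h1 (hp.nonneg _)

lemma pos_of_ne {w : List α} (h : p w ≠ 0) : 0 < p w := lt_of_le_of_ne (hp.nonneg w) h.symm

lemma powSum_term_nonneg (w : List α) (q : ℝ) : 0 ≤ (if p w = 0 then 0 else p w ^ q) := by
  split_ifs
  · exact le_rfl
  · exact Real.rpow_nonneg (hp.nonneg w) q

lemma powSum_pos (n : ℕ) (q : ℝ) : 0 < powSum p n q := by
  obtain ⟨w, hw, hne⟩ : ∃ w ∈ words α n, p w ≠ 0 := by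
    by_contra! h
    have := hp.sum_words n
    rw [Finset.sum_eq_zero h] at this
    exact zero_ne_one this
  refine Finset.sum_pos' (fun w _ => hp.powSum_term_nonneg w q) ⟨w, hw, ?_⟩
  rw [if_neg hne]
  exact Real.rpow_pos_of_pos (hp.pos_of_ne hne) q

lemma powSum_one (n : ℕ) : powSum p n 1 = 1 := by
  refine Eq.trans (Finset.sum_congr rfl fun w _ => ?_) (hp.sum_words n)
  split_ifs with h
  · exact h.symm
  · exact Real.rpow_one _

/-- Dropping uncharged words is compatible with concatenation by `append_eq_zero`. For `q < 0` the
two quasi-multiplicative inequalities exchange roles, whence the `|q|`. -/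
lemma powSum_add_bounds (n k : ℕ) (q : ℝ) :
    C ^ (-|q|) * (powSum p n q * powSum p k q) ≤ powSum p (n + k) q ∧
      powSum p (n + k) q ≤ C ^ |q| * (powSum p n q * powSum p k q) := by
  unfold powSum
  rw [sum_words_add, Finset.sum_mul_sum, Finset.mul_sum, Finset.mul_sum]
  simp only [Finset.mul_sum]
  have key : ∀ u v : List α,
      C ^ (-|q|) * ((if p u = 0 then 0 else p u ^ q) * (if p v = 0 then 0 else p v ^ q)) ≤
        (if p (u ++ v) = 0 then 0 else p (u ++ v) ^ q) ∧
      (if p (u ++ v) = 0 then 0 else p (u ++ v) ^ q) ≤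
        C ^ |q| * ((if p u = 0 then 0 else p u ^ q) * (if p v = 0 then 0 else p v ^ q)) := by
    intro u v
    by_cases hu : p u = 0
    · have : p (u ++ v) = 0 := (hp.append_eq_zero u v).2 (Or.inl hu)
      simp [hu, this]
    by_cases hv : p v = 0
    · have : p (u ++ v) = 0 := (hp.append_eq_zero u v).2 (Or.inr hv)
      simp [hv, this]
    have huv : p (u ++ v) ≠ 0 := by
      rw [Ne, hp.append_eq_zero]; tauto
    rw [if_neg hu, if_neg hv, if_neg huv, ← Real.mul_rpow (hp.nonneg u) (hp.nonneg v)]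
    exact rpow_bounds (hp.pos_of_ne huv) (mul_pos (hp.pos_of_ne hu) (hp.pos_of_ne hv)) hp.one_le
      (hp.lower u v) (hp.upper u v)
  exact ⟨Finset.sum_le_sum fun u _ => Finset.sum_le_sum fun v _ => (key u v).1,
    Finset.sum_le_sum fun u _ => Finset.sum_le_sum fun v _ => (key u v).2⟩

lemma abs_log_powSum_add (n k : ℕ) (q : ℝ) :
    |Real.log (powSum p (n + k) q) - Real.log (powSum p n q) - Real.log (powSum p k q)| ≤
      |q| * Real.log C := by
  obtain ⟨h1, h2⟩ := hp.powSum_add_bounds n k q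
  have hn := hp.powSum_pos n q
  have hk := hp.powSum_pos k q
  have hnk := hp.powSum_pos (n + k) q
  have hC := hp.C_pos
  have hC1 := Real.rpow_pos_of_pos hC (-|q|)
  have hC2 := Real.rpow_pos_of_pos hC |q|
  have l1 := Real.log_le_log (by positivity) h1
  have l2 := Real.log_le_log hnk h2
  rw [Real.log_mul hC1.ne' (by positivity), Real.log_mul hn.ne' hk.ne', Real.log_rpow hC] at l1
  rw [Real.log_mul hC2.ne' (by positivity), Real.log_mul hn.ne' hk.ne', Real.log_rpow hC] at l2
  rw [abs_le]
  constructor <;> linarith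

end IsQuasiMultiplicative

/-- The function `τ` is the growth exponent, in base `b`, of the sums of `q`-th powers. -/
def IsSpectrum (p : List α → ℝ) (C b : ℝ) (τ : ℝ → ℝ) : Prop :=
  ∀ (n : ℕ) (q : ℝ), |Real.log (powSum p n q) - n * (Real.log b * τ q)| ≤ |q| * Real.log C

/-- The limsup is a limit with an error uniform in `n`. This error vanishes at `q = 0` and is only
linear in `q`; both features are exploited later. -/
lemma IsQuasiMultiplicative.isSpectrum {p : List α → ℝ} {C : ℝ} (hp : IsQuasiMultiplicative p C)
    {b : ℝ} (hb : 1 < b) :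
    IsSpectrum p C b fun q =>
      limsup (fun n : ℕ => 1 / ((n : ℝ) * Real.log b) * Real.log (powSum p n q)) atTop := by
  intro n q
  obtain ⟨r, hr, hr'⟩ := exists_tendsto_of_almost_additive
    (a := fun n => Real.log (powSum p n q)) fun n k => hp.abs_log_powSum_add n k q
  have hb' := Real.log_pos hb
  have : Tendsto (fun n : ℕ => 1 / ((n : ℝ) * Real.log b) * Real.log (powSum p n q)) atTop
      (𝓝 (r / Real.log b)) := by
    refine (hr.div_const (Real.log b)).congr fun n => ?_
    rw [div_div]; ring
  dsimp only
  rw [this.limsup_eq, mul_div_cancel₀ _ hb'.ne']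
  exact hr' n

end Words

/-! ### Convexity, the affine case and moment estimates for the spectrum. -/

section Words

variable {α : Type*} [Finite α]

namespace IsQuasiMultiplicative

variable {p : List α → ℝ} {C : ℝ} (hp : IsQuasiMultiplicative p C)
include hp

/-- Hölder's inequality with exponents `1 / a` and `1 / c`. -/
lemma powSum_convex_comb_le (n : ℕ) {a c : ℝ} (ha : 0 < a) (hc : 0 < c) (hac : a + c = 1)
    (q r : ℝ) : powSum p n (a * q + c * r) ≤ powSum p n q ^ a * powSum p n r ^ c := by
  have hpq : Real.HolderConjugate a⁻¹ c⁻¹ :=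
    Real.holderConjugate_iff.2 ⟨by rw [one_lt_inv₀ ha]; linarith, by simpa using hac⟩
  have key := Real.inner_le_Lp_mul_Lq_of_nonneg (words α n) hpq
    (f := fun w => (if p w = 0 then 0 else p w ^ q) ^ a)
    (g := fun w => (if p w = 0 then 0 else p w ^ r) ^ c)
    (fun w _ => Real.rpow_nonneg (hp.powSum_term_nonneg w q) a)
    (fun w _ => Real.rpow_nonneg (hp.powSum_term_nonneg w r) c)
  simp only [one_div, inv_inv] at key
  have e1 : ∀ w, ((if p w = 0 then 0 else p w ^ q) ^ a) ^ a⁻¹ = if p w = 0 then 0 else p w ^ q :=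
    fun w => Real.rpow_rpow_inv (hp.powSum_term_nonneg w q) ha.ne'
  have e2 : ∀ w, ((if p w = 0 then 0 else p w ^ r) ^ c) ^ c⁻¹ = if p w = 0 then 0 else p w ^ r :=
    fun w => Real.rpow_rpow_inv (hp.powSum_term_nonneg w r) hc.ne'
  simp only [e1, e2] at key
  refine le_trans (le_of_eq ?_) key
  refine Finset.sum_congr rfl fun w _ => ?_
  split_ifs with h
  · simp [Real.zero_rpow ha.ne']
  · have hw := hp.pos_of_ne h
    rw [← Real.rpow_mul hw.le, ← Real.rpow_mul hw.le, ← Real.rpow_add hw]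
    ring_nf

end IsQuasiMultiplicative

/-- The device that removes the bounded errors of `IsSpectrum` and leaves exact inequalities. -/
lemma nonpos_of_forall_nat_mul_le {x B : ℝ} (h : ∀ n : ℕ, n * x ≤ B) : x ≤ 0 := by
  by_contra! hx
  obtain ⟨n, hn⟩ := exists_nat_gt (B / x)
  rw [div_lt_iff₀ hx] at hn
  exact absurd (h n) (not_le.2 hn)

namespace IsSpectrum

variable {p : List α → ℝ} {C b : ℝ} {τ : ℝ → ℝ} (hs : IsSpectrum p C b τ)
  (hp : IsQuasiMultiplicative p C) (hb : 1 < b)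
include hs hp hb

lemma powSum_bounds (n : ℕ) (q : ℝ) :
    C ^ (-|q|) * b ^ (n * τ q) ≤ powSum p n q ∧ powSum p n q ≤ C ^ |q| * b ^ (n * τ q) := by
  have h := abs_le.1 (hs n q)
  have hZ := hp.powSum_pos n q
  have hC := hp.C_pos
  have hb0 : 0 < b := by linarith
  rw [Real.rpow_def_of_pos hC, Real.rpow_def_of_pos hC, Real.rpow_def_of_pos hb0, ← Real.exp_add,
    ← Real.exp_add, ← Real.le_log_iff_exp_le hZ, ← Real.log_le_iff_le_exp hZ]
  constructor <;> linarith [h.1, h.2]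

lemma apply_one : τ 1 = 0 := by
  have hb' := Real.log_pos hb
  have h : ∀ n : ℕ, |n * (Real.log b * τ 1)| ≤ Real.log C := by
    intro n
    have := hs n 1
    rwa [hp.powSum_one, Real.log_one, zero_sub, abs_neg, abs_one, one_mul] at this
  have h1 := nonpos_of_forall_nat_mul_le fun n => (abs_le.1 (h n)).2
  have h2 := nonpos_of_forall_nat_mul_le (x := -(Real.log b * τ 1)) (B := Real.log C) fun n => by
    linarith [(abs_le.1 (h n)).1]
  nlinarith

lemma powSum_zero (n : ℕ) : powSum p n 0 = b ^ (n * τ 0) := by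
  have := hs.powSum_bounds hp hb n 0
  simp only [abs_zero, neg_zero, Real.rpow_zero, one_mul] at this
  exact le_antisymm this.2 this.1

lemma apply_two_nonpos : τ 2 ≤ 0 := by
  have hb' := Real.log_pos hb
  have h : ∀ n : ℕ, n * (Real.log b * τ 2) ≤ 2 * Real.log C := by
    intro n
    have h1 : powSum p n 2 ≤ 1 := by
      rw [← hp.powSum_one n]
      refine Finset.sum_le_sum fun w _ => ?_
      split_ifs with h
      · exact le_rfl
      · exact Real.rpow_le_rpow_of_exponent_ge (hp.pos_of_ne h) (hp.le_one w) one_le_two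
    have h2 := Real.log_nonpos (hp.powSum_pos n 2).le h1
    have h3 := (abs_le.1 (hs n 2)).1
    rw [abs_two] at h3
    linarith
  have := nonpos_of_forall_nat_mul_le h
  by_contra! hcon
  nlinarith

lemma convexOn : ConvexOn ℝ univ τ := by
  have hb' := Real.log_pos hb
  refine convexOn_iff_forall_pos.2 ⟨convex_univ, fun q _ r _ a c ha hc hac => ?_⟩
  simp only [smul_eq_mul]
  have key : ∀ n : ℕ, n * (Real.log b * (τ (a * q + c * r) - (a * τ q + c * τ r))) ≤
      (|a * q + c * r| + a * |q| + c * |r|) * Real.log C := by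
    intro n
    have h1 := Real.log_le_log (hp.powSum_pos n _) (hp.powSum_convex_comb_le n ha hc hac q r)
    have hq := hp.powSum_pos n q
    have hr := hp.powSum_pos n r
    rw [Real.log_mul (Real.rpow_pos_of_pos hq a).ne' (Real.rpow_pos_of_pos hr c).ne',
      Real.log_rpow hq, Real.log_rpow hr] at h1
    have h2 := (abs_le.1 (hs n (a * q + c * r))).1
    have h3 := mul_le_mul_of_nonneg_left (abs_le.1 (hs n q)).2 ha.le
    have h4 := mul_le_mul_of_nonneg_left (abs_le.1 (hs n r)).2 hc.le
    nlinarith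
  have := nonpos_of_forall_nat_mul_le key
  by_contra! hcon
  nlinarith

/-- Bound `p w ^ q` by the whole sum over the generation of `w`, take `q`-th roots and let `q → ∞`.
As the error is linear in `q`, it costs only the factor `C`. -/
lemma le_of_affine {δ : ℝ} (hτ : ∀ q, τ q = δ * (1 - q)) (w : List α) :
    p w ≤ C * b ^ (-(w.length * δ)) := by
  have hb0 : 0 < b := by linarith
  have hbp := Real.rpow_pos_of_pos hb0 (-(w.length * δ))
  have hC := hp.C_pos
  by_cases h : p w = 0
  · rw [h]; positivity
  have hw := hp.pos_of_ne h
  rw [← Real.log_le_log_iff hw (by positivity), Real.log_mul hC.ne' hbp.ne', Real.log_rpow hb0]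
  -- Here `n` is the exponent `q`; the generation `w.length` stays fixed.
  have key : ∀ n : ℕ, n * (Real.log (p w) - (Real.log C + -(w.length * δ) * Real.log b)) ≤
      w.length * δ * Real.log b := by
    intro n
    have h1 : p w ^ (n : ℝ) ≤ powSum p w.length n := by
      have := Finset.single_le_sum (f := fun v => if p v = 0 then 0 else p v ^ (n : ℝ))
        (fun v _ => hp.powSum_term_nonneg v n) (mem_words.2 (rfl : w.length = w.length))
      simpa [powSum, h] using this
    have h2 := Real.log_le_log (Real.rpow_pos_of_pos hw _) h1
    rw [Real.log_rpow hw] at h2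
    have h3 := (abs_le.1 (hs w.length n)).2
    rw [hτ, Nat.abs_cast] at h3
    linarith
  have := nonpos_of_forall_nat_mul_le key
  linarith

/-- The same argument with `q → -∞`, which is why `w` must be charged. -/
lemma ge_of_affine {δ : ℝ} (hτ : ∀ q, τ q = δ * (1 - q)) (w : List α) (h : p w ≠ 0) :
    b ^ (-(w.length * δ)) ≤ C * p w := by
  have hb0 : 0 < b := by linarith
  have hbp := Real.rpow_pos_of_pos hb0 (-(w.length * δ))
  have hC := hp.C_pos
  have hw := hp.pos_of_ne h
  rw [← Real.log_le_log_iff hbp (by positivity), Real.log_mul hC.ne' hw.ne', Real.log_rpow hb0]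
  have key : ∀ n : ℕ, n * (-(w.length * δ) * Real.log b - (Real.log C + Real.log (p w))) ≤
      w.length * δ * Real.log b := by
    intro n
    have h1 : p w ^ (-n : ℝ) ≤ powSum p w.length (-n) := by
      have := Finset.single_le_sum (f := fun v => if p v = 0 then 0 else p v ^ (-n : ℝ))
        (fun v _ => hp.powSum_term_nonneg v (-n)) (mem_words.2 (rfl : w.length = w.length))
      simpa [powSum, h] using this
    have h2 := Real.log_le_log (Real.rpow_pos_of_pos hw _) h1
    rw [Real.log_rpow hw] at h2
    have h3 := (abs_le.1 (hs w.length (-n))).2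
    rw [hτ, abs_neg, Nat.abs_cast] at h3
    linarith
  have := nonpos_of_forall_nat_mul_le key
  linarith

-- The moment of order `t` of the normalised mass `p w * b ^ (n s)` under the probability `p`. By
-- `powSum_bounds` it has order `b ^ (n (s t + τ (1 + t)))`.
omit hs in
lemma sum_tilted (n : ℕ) (s t : ℝ) :
    ∑ w ∈ words α n, p w * (p w * b ^ (n * s)) ^ t = b ^ (n * (s * t)) * powSum p n (1 + t) := by
  have hb0 : 0 < b := by linarith
  rw [powSum, Finset.mul_sum]
  refine Finset.sum_congr rfl fun w _ => ?_
  split_ifs with h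
  · simp [h]
  have hw := hp.pos_of_ne h
  rw [Real.mul_rpow hw.le (Real.rpow_nonneg hb0.le _), ← Real.rpow_mul hb0.le, Real.rpow_add hw,
    Real.rpow_one]
  ring_nf

/-- Exponential Chebyshev inequality. -/
lemma sum_filter_le (n : ℕ) (s t : ℝ) :
    ∑ w ∈ words α n with 1 ≤ (p w * b ^ (n * s)) ^ t, p w ≤
      C ^ |1 + t| * (b ^ (s * t + τ (1 + t))) ^ n := by
  have hb0 : 0 < b := by linarith
  have hbn : ∀ x : ℝ, 0 ≤ b ^ x := Real.rpow_nonneg hb0.le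
  calc ∑ w ∈ words α n with 1 ≤ (p w * b ^ (n * s)) ^ t, p w
      ≤ ∑ w ∈ words α n with 1 ≤ (p w * b ^ (n * s)) ^ t, p w * (p w * b ^ (n * s)) ^ t := by
        refine Finset.sum_le_sum fun w hw => ?_
        exact le_mul_of_one_le_right (hp.nonneg w) (Finset.mem_filter.1 hw).2
    _ ≤ ∑ w ∈ words α n, p w * (p w * b ^ (n * s)) ^ t := by
        refine Finset.sum_le_sum_of_subset_of_nonneg (Finset.filter_subset _ _) fun w _ _ => ?_
        exact mul_nonneg (hp.nonneg w) (Real.rpow_nonneg (mul_nonneg (hp.nonneg w) (hbn _)) _)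
    _ ≤ b ^ (n * (s * t)) * powSum p n (1 + t) := (sum_tilted hp hb n s t).le
    _ ≤ b ^ (n * (s * t)) * (C ^ |1 + t| * b ^ (n * τ (1 + t))) :=
        mul_le_mul_of_nonneg_left (hs.powSum_bounds hp hb n (1 + t)).2 (hbn _)
    _ = C ^ |1 + t| * (b ^ (s * t + τ (1 + t))) ^ n := by
        rw [← Real.rpow_natCast, ← Real.rpow_mul hb0.le, mul_left_comm, ← Real.rpow_add hb0]
        ring_nf

/-- Along a sequence of generations, `p w` deviates from `b ^ (-n d)` with a probability bounded
from below. -/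
lemma exists_le_sum_filter {d M : ℝ} (hφ0 : Tendsto (fun t => τ (1 + t) + d * t) (𝓝 0) (𝓝 0))
    (hφ : ∀ᶠ t in 𝓝[≠] (0 : ℝ), 0 < τ (1 + t) + d * t ∧
      τ (1 + 2 * t) + d * (2 * t) ≤ M * (τ (1 + t) + d * t)) :
    ∃ c > 0, ∀ N : ℕ, ∀ᶠ t in 𝓝[≠] (0 : ℝ), ∃ n ≥ N,
      c ≤ ∑ w ∈ words α n with 2 ≤ (p w * b ^ (n * d)) ^ t, p w := by
  have hb0 : 0 < b := by linarith
  have hbn : ∀ x : ℝ, 0 ≤ b ^ x := Real.rpow_nonneg hb0.le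
  have hC := hp.C_pos
  have hC1 := hp.one_le
  -- With `b ^ R = 3 C ^ 2` the first moment below is at least `3`, since `|1 + t| ≤ 2` limits the
  -- multiplicative error to `C ^ 2`.
  set R : ℝ := Real.logb b (3 * C ^ (2 : ℝ)) with hR
  have hC2 : 0 < C ^ (2 : ℝ) := Real.rpow_pos_of_pos hC _
  have hbR : b ^ R = 3 * C ^ (2 : ℝ) := Real.rpow_logb hb0 hb.ne' (by positivity)
  have hR0 : 0 < R := by
    apply Real.logb_pos hb
    have : 1 ≤ C ^ (2 : ℝ) := Real.one_le_rpow hC1 (by norm_num)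
    linarith
  have hc' : 0 < C ^ (2 : ℝ) * b ^ (max M 0 * (R + 1)) := mul_pos hC2 (Real.rpow_pos_of_pos hb0 _)
  refine ⟨1 / (C ^ (2 : ℝ) * b ^ (max M 0 * (R + 1))), by positivity, fun N => ?_⟩
  have hsmall : ∀ᶠ t in 𝓝[≠] (0 : ℝ), |t| < 1 / 2 := by
    refine eventually_nhdsWithin_of_eventually_nhds ?_
    have : Tendsto (fun t : ℝ => |t|) (𝓝 0) (𝓝 0) := by simpa using (continuous_abs.tendsto (0 : ℝ))
    exact this.eventually_lt_const (by norm_num)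
  have hlt : ∀ ε > 0, ∀ᶠ t in 𝓝[≠] (0 : ℝ), τ (1 + t) + d * t < ε := fun ε hε =>
    eventually_nhdsWithin_of_eventually_nhds (hφ0.eventually_lt_const hε)
  filter_upwards [hsmall, hφ, hlt 1 one_pos, hlt (R / (N + 1)) (by positivity)] with t ht h1 h2 h3
  obtain ⟨h1, hdbl⟩ := h1
  set φ := τ (1 + t) + d * t with hφdef
  have htabs := abs_lt.1 ht
  -- This generation places `n φ` between `R` and `R + 1`, so the moments are neither too small nor
  -- unbounded; it exceeds `N` because `φ` is small.
  refine ⟨⌈R / φ⌉₊, ?_, ?_⟩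
  · have : (N : ℝ) ≤ ⌈R / φ⌉₊ := by
      refine le_trans ?_ (Nat.le_ceil _)
      rw [lt_div_iff₀ (by positivity)] at h3
      rw [le_div_iff₀ h1]
      nlinarith
    exact_mod_cast this
  set n := ⌈R / φ⌉₊ with hn
  have hn1 : R ≤ n * φ := by
    have := Nat.le_ceil (R / φ)
    rwa [div_le_iff₀ h1] at this
  have hn2 : n * φ ≤ R + 1 := by
    have := (Nat.ceil_lt_add_one (div_nonneg hR0.le h1.le)).le
    have h4 : (n : ℝ) * φ ≤ (R / φ + 1) * φ := mul_le_mul_of_nonneg_right this h1.le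
    rw [add_mul, div_mul_cancel₀ _ h1.ne'] at h4
    linarith
  set y : List α → ℝ := fun w => p w * b ^ (n * d) with hy
  have hy0 : ∀ w, 0 ≤ y w := fun w => mul_nonneg (hp.nonneg w) (hbn _)
  set A := (words α n).filter fun w => 2 ≤ y w ^ t with hA
  have hlow : 3 ≤ ∑ w ∈ words α n, p w * y w ^ t := by
    refine le_trans ?_ (sum_tilted hp hb n d t).ge
    have e1 := (hs.powSum_bounds hp hb n (1 + t)).1
    have e2 : C ^ (-(2 : ℝ)) ≤ C ^ (-|1 + t|) := by
      apply Real.rpow_le_rpow_of_exponent_le hC1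
      have : |1 + t| ≤ 2 := abs_le.2 ⟨by linarith, by linarith⟩
      linarith
    calc (3 : ℝ) = C ^ (-(2 : ℝ)) * b ^ R := by
          rw [hbR, Real.rpow_neg hC.le]; field_simp
      _ ≤ C ^ (-|1 + t|) * b ^ (n * φ) :=
          mul_le_mul e2 (Real.rpow_le_rpow_of_exponent_le hb.le hn1) (hbn _)
            (Real.rpow_nonneg hC.le _)
      _ = b ^ (n * (d * t)) * (C ^ (-|1 + t|) * b ^ (n * τ (1 + t))) := by
          rw [mul_left_comm, ← Real.rpow_add hb0]
          congr 2
          rw [hφdef]; ring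
      _ ≤ _ := mul_le_mul_of_nonneg_left e1 (hbn _)
  -- The second moment is governed by `φ(2t)`, and doubling gives `n φ(2t) ≤ max M 0 * (R + 1)`.
  have hup : ∑ w ∈ words α n, p w * (y w ^ t) ^ 2 ≤ C ^ (2 : ℝ) * b ^ (max M 0 * (R + 1)) := by
    have e0 : ∀ w, p w * (y w ^ t) ^ 2 = p w * y w ^ (2 * t) := fun w => by
      rw [← Real.rpow_natCast, ← Real.rpow_mul (hy0 w)]
      push_cast
      ring_nf
    simp only [e0]
    refine (sum_tilted hp hb n d (2 * t)).le.trans ?_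
    have e1 := (hs.powSum_bounds hp hb n (1 + 2 * t)).2
    have e2 : C ^ |1 + 2 * t| ≤ C ^ (2 : ℝ) := by
      apply Real.rpow_le_rpow_of_exponent_le hC1
      exact abs_le.2 ⟨by linarith, by linarith⟩
    calc b ^ (n * (d * (2 * t))) * powSum p n (1 + 2 * t)
        ≤ b ^ (n * (d * (2 * t))) * (C ^ |1 + 2 * t| * b ^ (n * τ (1 + 2 * t))) :=
          mul_le_mul_of_nonneg_left e1 (hbn _)
      _ = C ^ |1 + 2 * t| * b ^ (n * (τ (1 + 2 * t) + d * (2 * t))) := by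
          rw [mul_left_comm, ← Real.rpow_add hb0]
          ring_nf
      _ ≤ C ^ (2 : ℝ) * b ^ (max M 0 * (R + 1)) := by
          refine mul_le_mul e2 (Real.rpow_le_rpow_of_exponent_le hb.le ?_) (hbn _) hC2.le
          calc n * (τ (1 + 2 * t) + d * (2 * t)) ≤ n * (max M 0 * φ) := by
                refine mul_le_mul_of_nonneg_left (hdbl.trans ?_) (Nat.cast_nonneg n)
                exact mul_le_mul_of_nonneg_right (le_max_left _ _) h1.le
            _ = max M 0 * (n * φ) := by ring
            _ ≤ _ := mul_le_mul_of_nonneg_left hn2 (le_max_right _ _)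
  -- Paley-Zygmund: off `A` the mean is at most `2` out of at least `3`, and Cauchy-Schwarz on `A`
  -- then bounds the probability of `A` from below.
  have hA1 : 1 ≤ ∑ w ∈ A, p w * y w ^ t := by
    have e1 := Finset.sum_filter_add_sum_filter_not (words α n) (fun w => 2 ≤ y w ^ t)
      (fun w => p w * y w ^ t)
    have e2 : ∑ w ∈ words α n with ¬ 2 ≤ y w ^ t, p w * y w ^ t ≤ 2 := by
      calc ∑ w ∈ words α n with ¬ 2 ≤ y w ^ t, p w * y w ^ t
          ≤ ∑ w ∈ words α n with ¬ 2 ≤ y w ^ t, p w * 2 := by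
            refine Finset.sum_le_sum fun w hw => mul_le_mul_of_nonneg_left ?_ (hp.nonneg w)
            exact (not_le.1 (Finset.mem_filter.1 hw).2).le
        _ ≤ ∑ w ∈ words α n, p w * 2 :=
            Finset.sum_le_sum_of_subset_of_nonneg (Finset.filter_subset _ _)
              fun w _ _ => mul_nonneg (hp.nonneg w) zero_le_two
        _ = 2 := by rw [← Finset.sum_mul, hp.sum_words, one_mul]
    linarith
  have hcs : (∑ w ∈ A, p w * y w ^ t) ^ 2 ≤ (∑ w ∈ A, p w) * ∑ w ∈ A, p w * (y w ^ t) ^ 2 := by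
    refine Finset.sum_sq_le_sum_mul_sum_of_sq_le_mul A (fun w _ => hp.nonneg w)
      (fun w _ => mul_nonneg (hp.nonneg w) (sq_nonneg _)) fun w _ => le_of_eq ?_
    ring
  have hA2 : ∑ w ∈ A, p w * (y w ^ t) ^ 2 ≤ C ^ (2 : ℝ) * b ^ (max M 0 * (R + 1)) :=
    (Finset.sum_le_sum_of_subset_of_nonneg (Finset.filter_subset _ _)
      fun w _ _ => mul_nonneg (hp.nonneg w) (sq_nonneg _)).trans hup
  rw [div_le_iff₀ hc']
  have hA0 : 0 ≤ ∑ w ∈ A, p w := Finset.sum_nonneg fun w _ => hp.nonneg w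
  have := mul_le_mul_of_nonneg_left hA2 hA0
  nlinarith

end IsSpectrum

end Words

/-! ### Two facts from real analysis: tangents of convex functions, zeros of analytic functions. -/

lemma _root_.ConvexOn.add_mul_sub_le_of_hasDerivAt {f : ℝ → ℝ} (hf : ConvexOn ℝ univ f)
    {x f' : ℝ} (h : HasDerivAt f f' x) (y : ℝ) : f x + f' * (y - x) ≤ f y := by
  rcases lt_trichotomy x y with hxy | rfl | hxy
  · have := hf.le_slope_of_hasDerivAt (mem_univ x) (mem_univ y) hxy h
    rw [slope_def_field, le_div_iff₀ (by linarith)] at this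
    linarith
  · simp
  · have := hf.slope_le_of_hasDerivAt (mem_univ y) (mem_univ x) hxy h
    rw [slope_def_field, div_le_iff₀ (by linarith)] at this
    linarith

/-- A nonzero analytic function is doubling near a zero. -/
lemma _root_.AnalyticAt.eventually_norm_two_mul_le {g : ℝ → ℝ} (hg : AnalyticAt ℝ g 0)
    (h : ¬ ∀ᶠ t in 𝓝 (0 : ℝ), g t = 0) :
    ∃ M, ∀ᶠ t in 𝓝[≠] (0 : ℝ), g t ≠ 0 ∧ |g (2 * t)| ≤ M * |g t| := by
  obtain ⟨k, u, hu, hu0, hgu⟩ := hg.exists_eventuallyEq_pow_smul_nonzero_iff.2 h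
  simp only [sub_zero, smul_eq_mul] at hgu
  have hu0' : 0 < |u 0| := abs_pos.2 hu0
  have hc : Tendsto (fun t => |u t|) (𝓝 0) (𝓝 |u 0|) := hu.continuousAt.tendsto.abs
  have h2 : Tendsto (fun t : ℝ => 2 * t) (𝓝 0) (𝓝 0) := by
    simpa using (continuous_const_mul (2 : ℝ)).tendsto 0
  have e1 : ∀ᶠ t in 𝓝 (0 : ℝ), |u 0| / 2 < |u t| := hc.eventually_const_lt (by linarith)
  have e2 : ∀ᶠ t in 𝓝 (0 : ℝ), |u t| < 2 * |u 0| := hc.eventually_lt_const (by linarith)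
  -- With `g t = t ^ k * u t`, the power contributes `2 ^ k`, and the bounds on `u` contribute `2 |u
  -- 0| / (|u 0| / 2) = 4`.
  refine ⟨2 ^ k * 4, ?_⟩
  filter_upwards [eventually_nhdsWithin_of_eventually_nhds e1,
    eventually_nhdsWithin_of_eventually_nhds (h2.eventually e2),
    eventually_nhdsWithin_of_eventually_nhds hgu,
    eventually_nhdsWithin_of_eventually_nhds (h2.eventually hgu), self_mem_nhdsWithin]
    with t h1 h2 h3 h4 h5
  have hut : u t ≠ 0 := abs_pos.1 (by linarith)
  refine ⟨by rw [h3]; exact mul_ne_zero (pow_ne_zero k h5) hut, ?_⟩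
  rw [h3, h4, abs_mul, abs_mul, mul_pow, abs_mul, abs_of_pos (by positivity : (0 : ℝ) < 2 ^ k)]
  have h6 : |u (2 * t)| ≤ 4 * |u t| := by linarith
  calc 2 ^ k * |t ^ k| * |u (2 * t)| ≤ 2 ^ k * |t ^ k| * (4 * |u t|) := by gcongr
    _ = 2 ^ k * 4 * (|t ^ k| * |u t|) := by ring

/-! ### The dichotomy for the spectrum, fluctuations and large deviations. -/

section Words

variable {α : Type*} [Finite α]

namespace IsSpectrum

variable {p : List α → ℝ} {C b : ℝ} {τ : ℝ → ℝ} (hs : IsSpectrum p C b τ)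
  (hp : IsQuasiMultiplicative p C) (hb : 1 < b)
include hs hp hb

lemma tangent_le {d : ℝ} (hd : HasDerivAt τ (-d) 1) (q : ℝ) : d * (1 - q) ≤ τ q := by
  have := (hs.convexOn hp hb).add_mul_sub_le_of_hasDerivAt hd q
  rw [hs.apply_one hp hb] at this
  linarith

lemma neg_deriv_nonneg {d : ℝ} (hd : HasDerivAt τ (-d) 1) : 0 ≤ d := by
  have := hs.tangent_le hp hb hd 2
  linarith [hs.apply_two_nonpos hp hb]

lemma neg_deriv_le {d : ℝ} (hd : HasDerivAt τ (-d) 1) : d ≤ τ 0 := by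
  have := hs.tangent_le hp hb hd 0
  linarith

/-- On `(0, 1)` the graph lies below the chord from `(0, τ 0)` to `(1, 0)` and above the tangent at
`1`. When `d = τ 0` these lines coincide, and analyticity extends the identity to the whole line. -/
lemma affine_of_eq (hτ : AnalyticOnNhd ℝ τ univ) {d : ℝ} (hd : HasDerivAt τ (-d) 1)
    (h : d = τ 0) (q : ℝ) : τ q = d * (1 - q) := by
  have hIcc : ∀ q ∈ Ioo (0 : ℝ) 1, τ q = d * (1 - q) := by
    intro q hq
    refine le_antisymm ?_ (hs.tangent_le hp hb hd q)
    have := (hs.convexOn hp hb).2 (mem_univ 0) (mem_univ 1) (sub_nonneg.2 hq.2.le) hq.1.le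
      (sub_add_cancel 1 q)
    simp only [smul_eq_mul, mul_zero, mul_one, zero_add, hs.apply_one hp hb, ← h, add_zero] at this
    linarith
  have hlin : AnalyticOnNhd ℝ (fun q : ℝ => d * (1 - q)) univ := fun x _ => by fun_prop
  have heq : τ =ᶠ[𝓝 (1 / 2)] fun q : ℝ => d * (1 - q) := by
    filter_upwards [Ioo_mem_nhds (by norm_num : (0 : ℝ) < 1 / 2) (by norm_num : (1 / 2 : ℝ) < 1)]
      with q hq using hIcc q hq
  exact congrFun (hτ.eq_of_eventuallyEq hlin heq) q

/-- If `τ (1 + t) + d * t` vanished near `0` it would vanish everywhere by analyticity, but at `t =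
-1` its value is `τ 0 - d > 0`. -/
lemma exists_doubling_of_lt (hτ : AnalyticOnNhd ℝ τ univ) {d : ℝ} (hd : HasDerivAt τ (-d) 1)
    (h : d < τ 0) :
    ∃ M, ∀ᶠ t in 𝓝[≠] (0 : ℝ), 0 < τ (1 + t) + d * t ∧
      τ (1 + 2 * t) + d * (2 * t) ≤ M * (τ (1 + t) + d * t) := by
  have hg : AnalyticOnNhd ℝ (fun t => τ (1 + t) + d * t) univ := fun t _ => by
    have h1 : AnalyticAt ℝ (fun t => τ (1 + t)) t :=
      (hτ (1 + t) (mem_univ _)).comp (f := fun t => 1 + t) (by fun_prop)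
    exact h1.add (by fun_prop)
  have hne : ¬ ∀ᶠ t in 𝓝 (0 : ℝ), τ (1 + t) + d * t = 0 := by
    intro h0
    have := congrFun (hg.eq_of_eventuallyEq (g := fun _ => 0) (fun _ _ => analyticAt_const) h0) (-1)
    simp only [add_neg_cancel] at this
    linarith
  have hnn : ∀ t, 0 ≤ τ (1 + t) + d * t := fun t => by
    have := hs.tangent_le hp hb hd (1 + t)
    linarith
  obtain ⟨M, hM⟩ := (hg 0 (mem_univ _)).eventually_norm_two_mul_le hne
  refine ⟨M, hM.mono fun t ht => ⟨lt_of_le_of_ne (hnn t) ht.1.symm, ?_⟩⟩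
  have := ht.2
  rwa [abs_of_nonneg (hnn _), abs_of_nonneg (hnn _)] at this

lemma exists_fluctuation_aux (hτ : AnalyticOnNhd ℝ τ univ) {d : ℝ} (hd : HasDerivAt τ (-d) 1)
    (h : d < τ 0) :
    ∃ c > 0, ∀ N : ℕ, ∀ᶠ t in 𝓝[≠] (0 : ℝ), ∃ n ≥ N,
      c ≤ ∑ w ∈ words α n with 2 ≤ (p w * b ^ (n * d)) ^ t, p w := by
  obtain ⟨M, hM⟩ := hs.exists_doubling_of_lt hp hb hτ hd h
  refine hs.exists_le_sum_filter hp hb ?_ hM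
  have h1 : ContinuousAt (fun t => τ (1 + t) + d * t) 0 := by
    have : ContinuousAt (fun t => τ (1 + t)) 0 :=
      ContinuousAt.comp (f := fun t : ℝ => 1 + t) (hτ (1 + 0) (mem_univ _)).continuousAt
        (by fun_prop)
    exact this.add (by fun_prop)
  have := h1.tendsto
  simpa [hs.apply_one hp hb] using this

omit hs hp hb in
lemma eventually_rpow_lt_two {K : ℝ} (hK : 0 < K) : ∀ᶠ t in 𝓝 (0 : ℝ), K ^ t < 2 := by
  have : Tendsto (fun t : ℝ => K ^ t) (𝓝 0) (𝓝 1) := by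
    simpa using (Real.continuousAt_const_rpow (b := 0) hK.ne').tendsto
  exact this.eventually_lt_const one_lt_two

/-- With probability bounded from below, `p w` is much larger than `b ^ (-n d)`. -/
lemma exists_fluctuation_above (hτ : AnalyticOnNhd ℝ τ univ) {d : ℝ} (hd : HasDerivAt τ (-d) 1)
    (h : d < τ 0) :
    ∃ c > 0, ∀ K > 0, ∀ N : ℕ, ∃ n ≥ N,
      c ≤ ∑ w ∈ words α n with K * b ^ (-(n * d)) ≤ p w, p w := by
  have hb0 : 0 < b := by linarith
  obtain ⟨c, hc, H⟩ := hs.exists_fluctuation_aux hp hb hτ hd h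
  refine ⟨c, hc, fun K hK N => ?_⟩
  have e1 : ∀ᶠ t in 𝓝[>] (0 : ℝ), ∃ n ≥ N,
      c ≤ ∑ w ∈ words α n with 2 ≤ (p w * b ^ (n * d)) ^ t, p w :=
    (H N).filter_mono (nhdsWithin_mono (0 : ℝ) fun t ht => (ne_of_gt ht : t ≠ 0))
  -- Since `K ^ t → 1`, the fixed threshold `2` beats every `K`: for `t > 0`, `y ^ t ≥ 2 > K ^ t`
  -- gives `y ≥ K`.
  have e2 : ∀ᶠ t in 𝓝[>] (0 : ℝ), K ^ t < 2 :=
    eventually_nhdsWithin_of_eventually_nhds (eventually_rpow_lt_two hK)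
  obtain ⟨t, ⟨⟨n, hn, h1⟩, h2⟩, ht⟩ := ((e1.and e2).and self_mem_nhdsWithin).exists
  refine ⟨n, hn, h1.trans (Finset.sum_le_sum_of_subset_of_nonneg ?_ fun w _ _ => hp.nonneg w)⟩
  refine Finset.monotone_filter_right _ fun w _ hw => ?_
  have h3 : K ≤ p w * b ^ (n * d) :=
    (Real.rpow_le_rpow_iff hK.le (mul_nonneg (hp.nonneg w) (Real.rpow_nonneg hb0.le _)) ht).1
      (h2.le.trans hw)
  rw [Real.rpow_neg hb0.le, ← div_eq_mul_inv, div_le_iff₀ (Real.rpow_pos_of_pos hb0 _)]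
  exact h3

/-- With probability bounded from below, `p w` is much smaller than `b ^ (-n d)`. -/
lemma exists_fluctuation_below (hτ : AnalyticOnNhd ℝ τ univ) {d : ℝ} (hd : HasDerivAt τ (-d) 1)
    (h : d < τ 0) :
    ∃ c > 0, ∀ K > 0, ∀ N : ℕ, ∃ n ≥ N,
      c ≤ ∑ w ∈ words α n with p w ≤ K * b ^ (-(n * d)), p w := by
  have hb0 : 0 < b := by linarith
  obtain ⟨c, hc, H⟩ := hs.exists_fluctuation_aux hp hb hτ hd h
  refine ⟨c, hc, fun K hK N => ?_⟩
  -- Negative exponents reverse the comparison, so the same event now means a small mass.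
  have e1 : ∀ᶠ t in 𝓝[<] (0 : ℝ), ∃ n ≥ N,
      c ≤ ∑ w ∈ words α n with 2 ≤ (p w * b ^ (n * d)) ^ t, p w :=
    (H N).filter_mono (nhdsWithin_mono (0 : ℝ) fun t ht => (ne_of_lt ht : t ≠ 0))
  have e2 : ∀ᶠ t in 𝓝[<] (0 : ℝ), K ^ t < 2 :=
    eventually_nhdsWithin_of_eventually_nhds (eventually_rpow_lt_two hK)
  obtain ⟨t, ⟨⟨n, hn, h1⟩, h2⟩, ht⟩ := ((e1.and e2).and self_mem_nhdsWithin).exists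
  refine ⟨n, hn, h1.trans (Finset.sum_le_sum_of_subset_of_nonneg ?_ fun w _ _ => hp.nonneg w)⟩
  refine Finset.monotone_filter_right _ fun w _ hw => ?_
  have h3 : p w * b ^ (n * d) ≤ K := by
    by_contra! hlt
    have := Real.rpow_lt_rpow_of_neg hK hlt ht
    linarith
  rw [Real.rpow_neg hb0.le, ← div_eq_mul_inv, le_div_iff₀ (Real.rpow_pos_of_pos hb0 _)]
  exact h3

omit hs hp hb in
lemma hasDerivAt_shift {d : ℝ} (hd : HasDerivAt τ (-d) 1) (s : ℝ) :
    HasDerivAt (fun t => s * t + τ (1 + t)) (s - d) 0 := by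
  have h1 : HasDerivAt (fun t => τ (1 + t)) (-d) 0 := by
    have h0 : HasDerivAt τ (-d) (1 + 0) := by simpa using hd
    simpa using h0.comp_const_add 1 0
  simpa [sub_eq_add_neg] using ((hasDerivAt_id' (0 : ℝ)).const_mul s).fun_add h1

/-- The words with `p w ≥ b ^ (-n s)`, `s < d`, are exponentially rare. -/
lemma exists_sum_filter_ge_le {d : ℝ} (hd : HasDerivAt τ (-d) 1) {s : ℝ} (hsd : s < d) :
    ∃ A ρ : ℝ, 0 ≤ ρ ∧ ρ < 1 ∧ ∀ n : ℕ,
      ∑ w ∈ words α n with b ^ (-(n * s)) ≤ p w, p w ≤ A * ρ ^ n := by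
  have hb0 : 0 < b := by linarith
  have hder := hasDerivAt_shift hd s
  -- The Chebyshev exponent vanishes at `t = 0` with derivative `s - d < 0`.
  have hneg : ∀ᶠ t in 𝓝[>] (0 : ℝ), s * t + τ (1 + t) < 0 := by
    have := (hasDerivAt_iff_tendsto_slope.1 hder).mono_left
      (nhdsWithin_mono _ fun t (ht : 0 < t) => (ne_of_gt ht : t ≠ 0))
    filter_upwards [this.eventually_lt_const (sub_neg.2 hsd), self_mem_nhdsWithin] with t h1 h2
    rw [slope_def_field, sub_zero, div_lt_iff₀ h2] at h1
    simpa [hs.apply_one hp hb] using h1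
  obtain ⟨t, hlt, ht⟩ := (hneg.and self_mem_nhdsWithin).exists
  refine ⟨C ^ |1 + t|, b ^ (s * t + τ (1 + t)), Real.rpow_nonneg hb0.le _,
    Real.rpow_lt_one_of_one_lt_of_neg hb hlt, fun n => ?_⟩
  refine le_trans (Finset.sum_le_sum_of_subset_of_nonneg ?_ fun w _ _ => hp.nonneg w)
    (hs.sum_filter_le hp hb n s t)
  refine Finset.monotone_filter_right _ fun w _ hw => ?_
  refine Real.one_le_rpow ?_ (le_of_lt ht)
  rwa [Real.rpow_neg hb0.le, ← one_div, div_le_iff₀ (Real.rpow_pos_of_pos hb0 _)] at hw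

/-- The words with `p w ≤ b ^ (-n s)`, `d < s`, are exponentially rare. -/
lemma exists_sum_filter_le_le {d : ℝ} (hd : HasDerivAt τ (-d) 1) {s : ℝ} (hsd : d < s) :
    ∃ A ρ : ℝ, 0 ≤ ρ ∧ ρ < 1 ∧ ∀ n : ℕ,
      ∑ w ∈ words α n with p w ≤ b ^ (-(n * s)), p w ≤ A * ρ ^ n := by
  have hb0 : 0 < b := by linarith
  have hder := hasDerivAt_shift hd s
  have hneg : ∀ᶠ t in 𝓝[<] (0 : ℝ), s * t + τ (1 + t) < 0 := by
    have := (hasDerivAt_iff_tendsto_slope.1 hder).mono_left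
      (nhdsWithin_mono _ fun t (ht : t < 0) => (ne_of_lt ht : t ≠ 0))
    filter_upwards [this.eventually_const_lt (sub_pos.2 hsd), self_mem_nhdsWithin] with t h1 h2
    rw [slope_def_field, sub_zero, lt_div_iff_of_neg h2] at h1
    simpa [hs.apply_one hp hb] using h1
  obtain ⟨t, hlt, ht⟩ := (hneg.and self_mem_nhdsWithin).exists
  refine ⟨C ^ |1 + t|, b ^ (s * t + τ (1 + t)), Real.rpow_nonneg hb0.le _,
    Real.rpow_lt_one_of_one_lt_of_neg hb hlt, fun n => ?_⟩
  refine le_trans ?_ (hs.sum_filter_le hp hb n s t)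
  -- The filters are not nested: an uncharged word satisfies the first condition but not the second,
  -- as `0 ^ t = 0`. It contributes nothing, so the sums are compared termwise.
  rw [Finset.sum_filter, Finset.sum_filter]
  refine Finset.sum_le_sum fun w _ => ?_
  by_cases hw0 : p w = 0
  · simp [hw0]
  have hw := hp.pos_of_ne hw0
  split_ifs with h1 h2
  · exact le_rfl
  · refine absurd (Real.one_le_rpow_of_pos_of_le_one_of_nonpos
      (mul_pos hw (Real.rpow_pos_of_pos hb0 _)) ?_ (le_of_lt ht)) h2
    rwa [Real.rpow_neg hb0.le, ← one_div, le_div_iff₀ (Real.rpow_pos_of_pos hb0 _)] at h1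
  · exact hw.le
  · exact le_rfl

end IsSpectrum

end Words

/-! ### Geometry of the coded cubes -/

lemma mem_cube_iff {D ℓ : ℕ} (hℓ : 2 ≤ ℓ) {n : ℕ} {k : Fin D → Fin (ℓ ^ n)} {x : E D} :
    x ∈ cube ℓ n k ↔ ∀ i, ⌊x i * (ℓ : ℝ) ^ n⌋ = ((k i : ℕ) : ℤ) := by
  have h0 : (0 : ℝ) < (ℓ : ℝ) ^ n := by positivity
  simp only [cube, mem_ofPred_eq, Int.floor_eq_iff, div_le_iff₀ h0, lt_div_iff₀ h0, Int.cast_natCast]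

/-- The constant `D + 1`, cruder than `√D`, stays positive when `D = 0`. -/
lemma dist_le_of_forall_coord {D : ℕ} {x y : E D} {ε : ℝ} (hε : 0 ≤ ε)
    (h : ∀ i, |x i - y i| ≤ ε) : dist x y ≤ (D + 1) * ε := by
  rw [EuclideanSpace.dist_eq]
  refine Real.sqrt_le_iff.2 ⟨by positivity, ?_⟩
  calc ∑ i, dist (x i) (y i) ^ 2 ≤ ∑ _i : Fin D, ε ^ 2 := by
        refine Finset.sum_le_sum fun i _ => ?_
        rw [Real.dist_eq]
        exact pow_le_pow_left₀ (abs_nonneg _) (h i) 2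
    _ = D * ε ^ 2 := by simp
    _ ≤ ((D + 1) * ε) ^ 2 := by
        rw [mul_pow]
        refine mul_le_mul_of_nonneg_right ?_ (sq_nonneg ε)
        have : (0 : ℝ) ≤ D := Nat.cast_nonneg D
        nlinarith

lemma abs_coord_sub_le_dist {D : ℕ} (x y : E D) (i : Fin D) : |x i - y i| ≤ dist x y := by
  rw [dist_eq_norm]
  simpa using PiLp.norm_apply_le (x - y) i

namespace IsCoding

variable {D ℓ : ℕ} {I : List (Fin (ℓ ^ D)) → Set (E D)} (hI : IsCoding I)
include hI

lemma exists_eq_cube (w : List (Fin (ℓ ^ D))) : ∃ k, I w = cube ℓ w.length k := by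
  obtain ⟨k, hk⟩ := (hI.bijOn w.length).mapsTo (rfl : w.length = w.length)
  exact ⟨k, hk.symm⟩

/-- The integer coordinates of the lower corner of the rescaled cube `I w`. -/
def corner (w : List (Fin (ℓ ^ D))) (i : Fin D) : ℤ :=
  (((hI.exists_eq_cube w).choose i : ℕ) : ℤ)

lemma eq_setOf (w : List (Fin (ℓ ^ D))) :
    I w = {x | ∀ i, (hI.corner w i : ℝ) / (ℓ : ℝ) ^ w.length ≤ x i ∧
      x i < ((hI.corner w i : ℝ) + 1) / (ℓ : ℝ) ^ w.length} := by
  conv_lhs => rw [(hI.exists_eq_cube w).choose_spec]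
  simp [cube, corner]

lemma mem_iff (hℓ : 2 ≤ ℓ) {w : List (Fin (ℓ ^ D))} {x : E D} :
    x ∈ I w ↔ ∀ i, ⌊x i * (ℓ : ℝ) ^ w.length⌋ = hI.corner w i := by
  conv_lhs => rw [(hI.exists_eq_cube w).choose_spec]
  exact mem_cube_iff hℓ

lemma nonempty (hℓ : 2 ≤ ℓ) (w : List (Fin (ℓ ^ D))) : (I w).Nonempty := by
  have h0 : (0 : ℝ) < (ℓ : ℝ) ^ w.length := by positivity
  refine ⟨WithLp.toLp 2 fun i => (hI.corner w i : ℝ) / (ℓ : ℝ) ^ w.length,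
    (hI.mem_iff hℓ).2 fun i => ?_⟩
  simp [div_mul_cancel₀ _ h0.ne']

lemma corner_injOn {w w' : List (Fin (ℓ ^ D))} (hlen : w.length = w'.length)
    (h : hI.corner w = hI.corner w') : w = w' := by
  refine (hI.bijOn w'.length).injOn hlen rfl ?_
  rw [hI.eq_setOf w, hI.eq_setOf w', h, hlen]

lemma eq_of_mem (hℓ : 2 ≤ ℓ) {w w' : List (Fin (ℓ ^ D))} (hlen : w.length = w'.length) {x : E D}
    (hx : x ∈ I w) (hx' : x ∈ I w') : w = w' := by
  refine hI.corner_injOn hlen (funext fun i => ?_)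
  rw [← (hI.mem_iff hℓ).1 hx i, ← (hI.mem_iff hℓ).1 hx' i, hlen]

lemma measurableSet (w : List (Fin (ℓ ^ D))) : MeasurableSet (I w) := by
  rw [hI.eq_setOf w]
  have : ∀ i : Fin D, Measurable fun x : E D => x i := fun i =>
    (EuclideanSpace.proj (𝕜 := ℝ) i).continuous.measurable
  simp only [ofPred_forall, ofPred_and]
  exact MeasurableSet.iInter fun i => (measurableSet_le measurable_const (this i)).inter
    (measurableSet_lt (this i) measurable_const)

lemma exists_mem (hℓ : 2 ≤ ℓ) {x : E D} (hx : x ∈ unitCube D) (n : ℕ) :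
    ∃ w ∈ words (Fin (ℓ ^ D)) n, x ∈ I w := by
  have h0 : (0 : ℝ) < (ℓ : ℝ) ^ n := by positivity
  have hlt : ∀ i, ⌊x i * (ℓ : ℝ) ^ n⌋₊ < ℓ ^ n := fun i => by
    rw [Nat.floor_lt (mul_nonneg (hx i).1 h0.le)]
    push_cast
    nlinarith [(hx i).2]
  obtain ⟨w, hw, hIw⟩ := (hI.bijOn n).surjOn (mem_range_self fun i => ⟨_, hlt i⟩)
  refine ⟨w, mem_words.2 hw, ?_⟩
  rw [hIw, mem_cube_iff hℓ]
  intro i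
  exact (Int.natCast_floor_eq_floor (mul_nonneg (hx i).1 h0.le)).symm

lemma subset_unitCube (hℓ : 2 ≤ ℓ) (w : List (Fin (ℓ ^ D))) : I w ⊆ unitCube D := by
  rw [(hI.exists_eq_cube w).choose_spec]
  intro x hx i
  have h0 : (0 : ℝ) < (ℓ : ℝ) ^ w.length := by positivity
  obtain ⟨h1, h2⟩ := hx i
  refine ⟨le_trans (by positivity) h1, h2.trans_le ?_⟩
  rw [div_le_one h0]
  exact_mod_cast ((hI.exists_eq_cube w).choose i).2

lemma append_subset (u v : List (Fin (ℓ ^ D))) : I (u ++ v) ⊆ I u := by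
  induction v using List.reverseRecOn with
  | nil => simp
  | append_singleton v a ih =>
    rw [← List.append_assoc]
    exact (hI.nested _ a).trans ih

/-- The word of length `u.length + n` whose cube contains `x` must begin with `u`, because cubes of
one generation are disjoint. -/
lemma exists_append_mem (hℓ : 2 ≤ ℓ) {u : List (Fin (ℓ ^ D))} {x : E D} (hx : x ∈ I u) (n : ℕ) :
    ∃ v ∈ words (Fin (ℓ ^ D)) n, x ∈ I (u ++ v) := by
  obtain ⟨w, hw, hxw⟩ := hI.exists_mem hℓ (hI.subset_unitCube hℓ u hx) (u.length + n)
  rw [mem_words] at hw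
  have hsplit := List.take_append_drop u.length w
  have hu : w.take u.length = u := by
    refine hI.eq_of_mem hℓ (by simp [hw]) (x := x) ?_ hx
    rw [← hsplit] at hxw
    exact hI.append_subset _ _ hxw
  refine ⟨w.drop u.length, by simp [hw], ?_⟩
  rw [hu] at hsplit
  rwa [hsplit]

lemma subset_of_mem (hℓ : 2 ≤ ℓ) {u w : List (Fin (ℓ ^ D))} (hlen : u.length ≤ w.length) {x : E D}
    (hu : x ∈ I u) (hw : x ∈ I w) : I w ⊆ I u := by
  obtain ⟨v, hv, hx⟩ := hI.exists_append_mem hℓ hu (w.length - u.length)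
  rw [mem_words] at hv
  have : w = u ++ v := hI.eq_of_mem hℓ (by simp [hv]; omega) hw hx
  rw [this]
  exact hI.append_subset u v

lemma nil_eq (hℓ : 2 ≤ ℓ) : I [] = unitCube D := by
  refine (hI.subset_unitCube hℓ []).antisymm fun x hx => ?_
  obtain ⟨w, hw, hxw⟩ := hI.exists_mem hℓ hx 0
  rw [mem_words, List.length_eq_zero_iff] at hw
  rwa [hw] at hxw

/-- Points of the support, and limits of nested cubes, may lie on faces missing from the half-open
cubes; closed cubes are used for them. -/
lemma closure_subset (w : List (Fin (ℓ ^ D))) :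
    closure (I w) ⊆ {x | ∀ i, (hI.corner w i : ℝ) / (ℓ : ℝ) ^ w.length ≤ x i ∧
      x i ≤ ((hI.corner w i : ℝ) + 1) / (ℓ : ℝ) ^ w.length} := by
  refine closure_minimal ?_ ?_
  · conv_lhs => rw [hI.eq_setOf w]
    exact fun x hx i => ⟨(hx i).1, (hx i).2.le⟩
  · have : ∀ i : Fin D, Continuous fun x : E D => x i := fun i =>
      (EuclideanSpace.proj (𝕜 := ℝ) i).continuous
    simp only [ofPred_forall, ofPred_and]
    exact isClosed_iInter fun i => (isClosed_le continuous_const (this i)).inter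
      (isClosed_le (this i) continuous_const)

lemma dist_le_of_mem_closure {w : List (Fin (ℓ ^ D))} {x y : E D} (hx : x ∈ closure (I w))
    (hy : y ∈ closure (I w)) : dist x y ≤ (D + 1) * ((ℓ : ℝ) ^ w.length)⁻¹ := by
  refine dist_le_of_forall_coord (by positivity) fun i => ?_
  obtain ⟨h1, h2⟩ := hI.closure_subset w hx i
  obtain ⟨h3, h4⟩ := hI.closure_subset w hy i
  rw [add_div, one_div] at h2 h4
  rw [abs_le]
  constructor <;> linarith

lemma ediam_closure_le (w : List (Fin (ℓ ^ D))) :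
    Metric.ediam (closure (I w)) ≤ ENNReal.ofReal ((D + 1) * ((ℓ : ℝ) ^ w.length)⁻¹) := by
  refine Metric.ediam_le fun x hx y hy => ?_
  rw [edist_dist]
  exact ENNReal.ofReal_le_ofReal (hI.dist_le_of_mem_closure hx hy)

/-- After rescaling by `ℓ ^ n`, each point is within `1` of its corner in every coordinate, on the
upper side, and the points differ by at most `1`. The five possible differences per coordinate are
the source of `5 ^ D`. -/
lemma abs_corner_sub_le (hℓ : 2 ≤ ℓ) {w w' : List (Fin (ℓ ^ D))} (hlen : w'.length = w.length)
    {x y : E D} (hx : x ∈ closure (I w)) (hy : y ∈ closure (I w'))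
    (hxy : dist x y ≤ ((ℓ : ℝ) ^ w.length)⁻¹) (i : Fin D) :
    |hI.corner w' i - hI.corner w i| ≤ 2 := by
  have h0 : (0 : ℝ) < (ℓ : ℝ) ^ w.length := by positivity
  obtain ⟨h1, h2⟩ := hI.closure_subset w hx i
  obtain ⟨h3, h4⟩ := hI.closure_subset w' hy i
  have h5 := abs_le.1 ((abs_coord_sub_le_dist x y i).trans hxy)
  rw [hlen] at h3 h4
  rw [div_le_iff₀ h0] at h1 h3
  rw [le_div_iff₀ h0] at h2 h4
  have h6 : (x i - y i) * (ℓ : ℝ) ^ w.length ≤ 1 := by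
    rw [← inv_mul_cancel₀ h0.ne']
    exact mul_le_mul_of_nonneg_right h5.2 h0.le
  have h7 : -1 ≤ (x i - y i) * (ℓ : ℝ) ^ w.length := by
    rw [← inv_mul_cancel₀ h0.ne', ← neg_mul]
    exact mul_le_mul_of_nonneg_right h5.1 h0.le
  rw [sub_mul] at h6 h7
  rw [abs_le]
  constructor
  · have : (-2 : ℝ) ≤ hI.corner w' i - hI.corner w i := by linarith
    exact_mod_cast this
  · have : (hI.corner w' i - hI.corner w i : ℝ) ≤ 2 := by linarith
    exact_mod_cast this

lemma card_le_of_corner {n : ℕ} (T : Finset (List (Fin (ℓ ^ D)))) (hT : ∀ w ∈ T, w.length = n)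
    (k : Fin D → ℤ) (h : ∀ w ∈ T, ∀ i, |hI.corner w i - k i| ≤ 2) : T.card ≤ 5 ^ D := by
  have hcard : (Fintype.piFinset fun i => Finset.Icc (k i - 2) (k i + 2)).card = 5 ^ D := by
    rw [Fintype.card_piFinset]
    have : ∀ i, (Finset.Icc (k i - 2) (k i + 2)).card = 5 := fun i => by
      rw [Int.card_Icc]; ring_nf; rfl
    simp [this]
  rw [← hcard]
  refine Finset.card_le_card_of_injOn hI.corner (fun w hw => ?_) fun w hw w' hw' heq => ?_
  · rw [Finset.mem_coe, Fintype.mem_piFinset]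
    intro i
    have := abs_le.1 (h w hw i)
    rw [Finset.mem_Icc]
    constructor <;> linarith [this.1, this.2]
  · exact hI.corner_injOn ((hT w hw).trans (hT w' hw').symm) heq

/-- At most `5 ^ D` closed cubes of generation `n` meet a set of diameter at most `ℓ ^ (-n)`. -/
lemma card_le_of_meets (hℓ : 2 ≤ ℓ) {n : ℕ} (T : Finset (List (Fin (ℓ ^ D))))
    (hT : ∀ w ∈ T, w.length = n) {U : Set (E D)}
    (hU : ∀ x ∈ U, ∀ y ∈ U, dist x y ≤ ((ℓ : ℝ) ^ n)⁻¹)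
    (h : ∀ w ∈ T, (closure (I w) ∩ U).Nonempty) : T.card ≤ 5 ^ D := by
  rcases T.eq_empty_or_nonempty with rfl | ⟨w₀, hw₀⟩
  · simp
  refine hI.card_le_of_corner T hT (hI.corner w₀) fun w hw i => ?_
  obtain ⟨x, hx, hxU⟩ := h w₀ hw₀
  obtain ⟨y, hy, hyU⟩ := h w hw
  refine hI.abs_corner_sub_le hℓ ((hT w hw).trans (hT w₀ hw₀).symm) hx hy ?_ i
  rw [hT w₀ hw₀]
  exact hU x hxU y hyU

open Classical in
omit hI in
/-- The words of the same length as `w` whose cubes come within distance `ℓ ^ (-n)` of `I w`. -/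
def _root_.QB.neighbours (I : List (Fin (ℓ ^ D)) → Set (E D)) (w : List (Fin (ℓ ^ D))) :
    Finset (List (Fin (ℓ ^ D))) :=
  (words (Fin (ℓ ^ D)) w.length).filter fun w' =>
    ∃ x ∈ I w, ∃ y ∈ I w', dist x y ≤ ((ℓ : ℝ) ^ w.length)⁻¹

omit hI in
lemma _root_.QB.mem_neighbours {w w' : List (Fin (ℓ ^ D))} :
    w' ∈ neighbours I w ↔ w'.length = w.length ∧
      ∃ x ∈ I w, ∃ y ∈ I w', dist x y ≤ ((ℓ : ℝ) ^ w.length)⁻¹ := by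
  simp [neighbours]

omit hI in
lemma _root_.QB.mem_neighbours_comm {w w' : List (Fin (ℓ ^ D))} :
    w' ∈ neighbours I w ↔ w ∈ neighbours I w' := by
  simp only [mem_neighbours]
  constructor <;>
  · rintro ⟨h, x, hx, y, hy, hxy⟩
    exact ⟨h.symm, y, hy, x, hx, by rwa [dist_comm, h]⟩

lemma card_neighbours_le (hℓ : 2 ≤ ℓ) (w : List (Fin (ℓ ^ D))) :
    (neighbours I w).card ≤ 5 ^ D := by
  refine hI.card_le_of_corner (n := w.length) _ (fun w' hw' => (mem_neighbours.1 hw').1)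
    (hI.corner w) fun w' hw' i => ?_
  obtain ⟨hlen, x, hx, y, hy, hxy⟩ := mem_neighbours.1 hw'
  exact hI.abs_corner_sub_le hℓ hlen (subset_closure hx) (subset_closure hy) hxy i

end IsCoding

/-! ### General measure-theoretic lemmas -/

/-- Continuity from above along the tails `⋃ n ≥ N, G n`; this is where finiteness of `μ` enters. -/
lemma le_measure_limsup {X : Type*} [MeasurableSpace X] {μ : Measure X} [IsFiniteMeasure μ]
    {G : ℕ → Set X} (hG : ∀ n, MeasurableSet (G n)) {c : ℝ≥0∞}
    (h : ∃ᶠ n in atTop, c ≤ μ (G n)) : c ≤ μ (limsup G atTop) := by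
  rw [limsup_eq_iInf_iSup_of_nat]
  simp only [iInf_eq_iInter, iSup_eq_iUnion]
  have hmeas : ∀ N, MeasurableSet (⋃ n, ⋃ (_ : n ≥ N), G n) := fun N =>
    MeasurableSet.iUnion fun n => MeasurableSet.iUnion fun _ => hG n
  have hanti : Antitone fun N => ⋃ n, ⋃ (_ : n ≥ N), G n := fun N N' hN =>
    iUnion_mono fun n => iUnion_subset fun hn => subset_iUnion_of_subset (hN.trans hn) subset_rfl
  refine ge_of_tendsto' (tendsto_measure_iInter_atTop (fun N => (hmeas N).nullMeasurableSet) hanti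
    ⟨0, measure_ne_top _ _⟩) fun N => ?_
  obtain ⟨n, hn, hc⟩ := frequently_atTop.1 h N
  exact hc.trans (measure_mono (subset_iUnion₂_of_subset n hn subset_rfl))

/-- Mass distribution principle along the scales `b ^ (-n)`. -/
lemma le_smul_hausdorffMeasure {X : Type*} [MetricSpace X] [MeasurableSpace X] [BorelSpace X]
    {μ : Measure X} {b s A : ℝ} (hb : 1 < b) (hs : 0 ≤ s) (hA : 0 < A) (N : ℕ)
    (h : ∀ n ≥ N, ∀ U : Set X, (∀ x ∈ U, ∀ y ∈ U, dist x y ≤ (b ^ n)⁻¹) →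
      μ U ≤ ENNReal.ofReal (A * b ^ (-(n * s)))) :
    μ ≤ ENNReal.ofReal (A * b ^ s) • (hausdorffMeasure s : Measure X) := by
  have hb0 : 0 < b := by linarith
  have hK : 0 < A * b ^ s := mul_pos hA (Real.rpow_pos_of_pos hb0 s)
  set K := ENNReal.ofReal (A * b ^ s) with hKdef
  have hK0 : K ≠ 0 := by simpa [hKdef] using hK
  have hKt : K ≠ ∞ := ENNReal.ofReal_ne_top
  have key : K⁻¹ • μ ≤ (hausdorffMeasure s : Measure X) := by
    refine le_hausdorffMeasure s _ (ENNReal.ofReal (b ^ N)⁻¹) (by simp; positivity) fun U hU => ?_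
    rw [Measure.smul_apply, smul_eq_mul, mul_comm, ← div_eq_mul_inv]
    refine ENNReal.div_le_of_le_mul' ?_
    have hdist : ∀ n : ℕ, Metric.ediam U ≤ ENNReal.ofReal (b ^ n)⁻¹ →
        ∀ x ∈ U, ∀ y ∈ U, dist x y ≤ (b ^ n)⁻¹ := fun n hn x hx y hy => by
      have := (Metric.edist_le_ediam_of_mem hx hy).trans hn
      rw [edist_dist] at this
      exact (ENNReal.ofReal_le_ofReal_iff (by positivity)).1 this
    -- A set of diameter `0` satisfies the hypothesis at all scales, so it is null if `s > 0`; for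
    -- `s = 0` the convention `0 ^ 0 = 1` suffices.
    rcases eq_or_ne (Metric.ediam U) 0 with h0 | h0
    · have hall : ∀ n ≥ N, μ U ≤ ENNReal.ofReal (A * b ^ (-(n * s))) := fun n hn =>
        h n hn U (hdist n (by rw [h0]; exact zero_le))
      rcases hs.eq_or_lt with rfl | hs'
      · simpa [hKdef] using hall N le_rfl
      · have : Tendsto (fun n : ℕ => ENNReal.ofReal (A * b ^ (-(n * s)))) atTop (𝓝 0) := by
          rw [← ENNReal.ofReal_zero]
          refine ENNReal.tendsto_ofReal ?_
          have h1 : Tendsto (fun n : ℕ => (b ^ (-s)) ^ n) atTop (𝓝 0) :=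
            tendsto_pow_atTop_nhds_zero_of_lt_one (Real.rpow_nonneg hb0.le _)
              (Real.rpow_lt_one_of_one_lt_of_neg hb (by linarith))
          have h2 := h1.const_mul A
          rw [mul_zero] at h2
          refine h2.congr fun n => ?_
          rw [← Real.rpow_natCast, ← Real.rpow_mul hb0.le]
          ring_nf
        have h3 : μ U ≤ 0 := ge_of_tendsto this (eventually_atTop.2 ⟨N, hall⟩)
        exact h3.trans (zero_le)
    · have hfin : Metric.ediam U ≠ ∞ := ne_top_of_le_ne_top ENNReal.ofReal_ne_top hU
      set r := (Metric.ediam U).toReal with hr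
      have hr0 : 0 < r := ENNReal.toReal_pos h0 hfin
      have hrU : Metric.ediam U = ENNReal.ofReal r := (ENNReal.ofReal_toReal hfin).symm
      have hrN : r ≤ (b ^ N)⁻¹ := by
        rw [hrU] at hU
        exact (ENNReal.ofReal_le_ofReal_iff (by positivity)).1 hU
      have hN' : b ^ N ≤ r⁻¹ := by
        rw [le_inv_comm₀ (by positivity) hr0]; exact hrN
      -- Rounding the diameter up to a scale `b ^ (-n)` loses at most a factor `b`, hence the `b ^
      -- s` in the constant.
      obtain ⟨n, hn1, hn2⟩ := exists_nat_pow_near ((one_le_pow₀ hb.le).trans hN') hb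
      have hNn : N ≤ n := by
        have := (pow_lt_pow_iff_right₀ hb).1 (hN'.trans_lt hn2)
        omega
      have hle : r ≤ (b ^ n)⁻¹ := by
        rw [le_inv_comm₀ hr0 (by positivity)]; exact hn1
      refine (h n hNn U (hdist n (by rw [hrU]; exact ENNReal.ofReal_le_ofReal hle))).trans ?_
      rw [hrU, ENNReal.ofReal_rpow_of_pos hr0, hKdef, ← ENNReal.ofReal_mul hK.le]
      refine ENNReal.ofReal_le_ofReal ?_
      rw [mul_assoc]
      refine mul_le_mul_of_nonneg_left ?_ hA.le
      rw [← Real.mul_rpow hb0.le hr0.le]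
      have h5 : b ^ (-(n * s)) = ((b ^ n)⁻¹) ^ s := by
        rw [neg_mul_eq_neg_mul, Real.rpow_mul hb0.le, Real.rpow_neg hb0.le, Real.rpow_natCast]
      rw [h5]
      refine Real.rpow_le_rpow (by positivity) ?_ hs
      rw [inv_le_iff_one_le_mul₀ (by positivity)]
      have := (inv_lt_iff_one_lt_mul₀ hr0).1 hn2
      rw [pow_succ] at this
      nlinarith
  intro S
  rw [Measure.smul_apply, smul_eq_mul]
  have := key S
  rw [Measure.smul_apply, smul_eq_mul, mul_comm, ← div_eq_mul_inv,
    ENNReal.div_le_iff_le_mul (Or.inl hK0) (Or.inl hKt)] at this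
  rwa [mul_comm]

/-- A measure is dominated by the packing pre-measure on the sets where its lower density is
bounded. -/
lemma measure_le_packingPre {X : Type*} [MetricSpace X] [SecondCountableTopology X]
    [MeasurableSpace X] {μ : Measure X} {b s K : ℝ} (hb : 1 < b) (hK : 0 < K)
    {A : Set X} (h : ∀ x ∈ A, ∃ᶠ n : ℕ in atTop,
      μ (Metric.closedBall x (b ^ n)⁻¹) ≤ ENNReal.ofReal (K * b ^ (-(n * s)))) :
    μ A ≤ ENNReal.ofReal (K * (5 / 2) ^ s) * packingPre s A := by
  classical
  have hb0 : 0 < b := by linarith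
  have h52 : (0 : ℝ) < (5 / 2) ^ s := Real.rpow_pos_of_pos (by norm_num) s
  set Q := ENNReal.ofReal (K * (5 / 2) ^ s) with hQ
  have hQ0 : Q ≠ 0 := by simpa [hQ] using mul_pos hK h52
  have hQt : Q ≠ ∞ := ENNReal.ofReal_ne_top
  suffices H : ∀ ε > 0, μ A ≤ Q * packingPreAt s ε A by
    rw [mul_comm, ← ENNReal.div_le_iff_le_mul (Or.inl hQ0) (Or.inl hQt)]
    refine le_iInf₂ fun ε hε => ?_
    rw [ENNReal.div_le_iff_le_mul (Or.inl hQ0) (Or.inl hQt), mul_comm]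
    exact H ε hε
  intro ε hε
  -- One fifth of the controlled radius: Vitali's fivefold enlargements are then balls of known
  -- mass, and `b ^ (-n) = (5 / 2) * (2 r)` explains the constant.
  set r : ℕ → ℝ := fun n => (b ^ n)⁻¹ / 5 with hr
  have hr0 : ∀ n, 0 < r n := fun n => by positivity
  have hr5 : ∀ n, 5 * r n = (b ^ n)⁻¹ := fun n => by simp only [hr]; ring
  set t : Set (X × ℕ) := {z | z.1 ∈ A ∧ r z.2 ≤ ε ∧
    μ (Metric.closedBall z.1 (b ^ z.2)⁻¹) ≤ ENNReal.ofReal (K * b ^ (-(z.2 * s)))} with ht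
  obtain ⟨u, hut, hdisj, hcov⟩ := Vitali.exists_disjoint_subfamily_covering_enlargement_closedBall
    t (fun z => z.1) (fun z => r z.2) ε (fun z hz => hz.2.1) 5 (by norm_num)
  have hucount : u.Countable := by
    refine hdisj.countable_of_nonempty_interior fun z _ => ?_
    exact ⟨z.1, Metric.ball_subset_interior_closedBall (Metric.mem_ball_self (hr0 _))⟩
  have hAcov : A ⊆ ⋃ z ∈ u, Metric.closedBall z.1 (b ^ z.2)⁻¹ := by
    intro x hx
    have hlim : ∀ᶠ n : ℕ in atTop, r n ≤ ε := by
      have h1 : Tendsto (fun n : ℕ => (b ^ n)⁻¹ / 5) atTop (𝓝 (0 / 5)) :=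
        (tendsto_inv_atTop_zero.comp (tendsto_pow_atTop_atTop_of_one_lt hb)).div_const 5
      rw [zero_div] at h1
      exact (h1.eventually_lt_const hε).mono fun n hn => hn.le
    obtain ⟨n, hn1, hn2⟩ := ((h x hx).and_eventually hlim).exists
    obtain ⟨z, hz, hsub⟩ := hcov (x, n) ⟨hx, hn2, hn1⟩
    rw [hr5] at hsub
    exact mem_biUnion hz (hsub (Metric.mem_closedBall_self (hr0 n).le))
  have hinj : Function.Injective fun z : X × ℕ => (z.1, r z.2) := by
    rintro ⟨x, n⟩ ⟨y, k⟩ hxy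
    simp only [Prod.mk.injEq, hr] at hxy
    obtain ⟨rfl, h2⟩ := hxy
    have h3 : b ^ n = b ^ k := inv_injective (by linarith)
    rw [(pow_right_injective₀ hb0 hb.ne') h3]
  have hcount : Countable u := hucount.to_subtype
  calc μ A ≤ μ (⋃ z ∈ u, Metric.closedBall z.1 (b ^ z.2)⁻¹) := measure_mono hAcov
    _ ≤ ∑' z : u, μ (Metric.closedBall z.1.1 (b ^ z.1.2)⁻¹) := measure_biUnion_le μ hucount _
    _ ≤ ∑' z : u, Q * ENNReal.ofReal ((2 * r z.1.2) ^ s) := by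
        refine ENNReal.tsum_le_tsum fun z => (hut z.2).2.2.trans (le_of_eq ?_)
        have e : 2 * r z.1.2 = (5 / 2)⁻¹ * (b ^ z.1.2)⁻¹ := by simp only [hr]; ring
        rw [hQ, ← ENNReal.ofReal_mul (by positivity), e,
          Real.mul_rpow (by norm_num) (by positivity), Real.inv_rpow (by norm_num),
          Real.inv_rpow (by positivity), ← Real.rpow_natCast, ← Real.rpow_mul hb0.le,
          Real.rpow_neg hb0.le]
        congr 1
        field_simp
    _ = Q * ∑' z : u, ENNReal.ofReal ((2 * r z.1.2) ^ s) := ENNReal.tsum_mul_left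
    _ ≤ Q * packingPreAt s ε A := by
        gcongr
        rw [ENNReal.tsum_eq_iSup_sum]
        refine iSup_le fun F => ?_
        have hinj' : Function.Injective fun z : u => (z.1.1, r z.1.2) :=
          hinj.comp Subtype.val_injective
        refine le_iSup₂_of_le (F.image fun z : u => (z.1.1, r z.1.2)) ⟨?_, ?_⟩ ?_
        · intro q hq
          obtain ⟨z, -, rfl⟩ := Finset.mem_image.1 hq
          exact ⟨(hut z.2).1, hr0 _, (hut z.2).2.1⟩
        · rintro q hq q' hq' hne
          rw [Finset.mem_coe, Finset.mem_image] at hq hq'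
          obtain ⟨z, -, rfl⟩ := hq
          obtain ⟨z', -, rfl⟩ := hq'
          refine hdisj z.2 z'.2 fun heq => hne ?_
          rw [Subtype.ext heq]
        · rw [Finset.sum_image fun _ _ _ _ h => hinj' h]

/-- The density condition is inherited by subsets, so the bound applies to each piece `t i ∩ A` of a
countable cover. -/
lemma measure_le_packingOuter {X : Type*} [MetricSpace X] [SecondCountableTopology X]
    [MeasurableSpace X] {μ : Measure X} {b s K : ℝ} (hb : 1 < b) (hK : 0 < K)
    {A : Set X} (h : ∀ x ∈ A, ∃ᶠ n : ℕ in atTop,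
      μ (Metric.closedBall x (b ^ n)⁻¹) ≤ ENNReal.ofReal (K * b ^ (-(n * s)))) :
    μ A ≤ ENNReal.ofReal (K * (5 / 2) ^ s) * packingOuter s A := by
  have h52 : (0 : ℝ) < (5 / 2) ^ s := Real.rpow_pos_of_pos (by norm_num) s
  set Q := ENNReal.ofReal (K * (5 / 2) ^ s) with hQ
  have hQ0 : Q ≠ 0 := by simpa [hQ] using mul_pos hK h52
  have hQt : Q ≠ ∞ := ENNReal.ofReal_ne_top
  rw [mul_comm, ← ENNReal.div_le_iff_le_mul (Or.inl hQ0) (Or.inl hQt)]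
  unfold packingOuter
  rw [OuterMeasure.ofFunction_apply]
  refine le_iInf₂ fun t ht => ?_
  rw [ENNReal.div_le_iff_le_mul (Or.inl hQ0) (Or.inl hQt), mul_comm, ← ENNReal.tsum_mul_left]
  have hA : A ⊆ ⋃ i, t i ∩ A := by
    rw [← iUnion_inter]
    exact subset_inter ht subset_rfl
  refine (measure_mono hA).trans ((measure_iUnion_le _).trans (ENNReal.tsum_le_tsum fun i => ?_))
  refine (measure_le_packingPre hb hK fun x hx => h x hx.2).trans ?_
  gcongr
  exact packingPre_mono s inter_subset_left

/-! ### Probability measures on the coded cubes -/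

lemma tendsto_mul_inv_pow {ℓ : ℕ} (hℓ : 2 ≤ ℓ) (c : ℝ) :
    Tendsto (fun n : ℕ => c * ((ℓ : ℝ) ^ n)⁻¹) atTop (𝓝 0) := by
  have h : Tendsto (fun n : ℕ => ((ℓ : ℝ) ^ n)⁻¹) atTop (𝓝 0) :=
    tendsto_inv_atTop_zero.comp (tendsto_pow_atTop_atTop_of_one_lt (by exact_mod_cast hℓ))
  simpa using h.const_mul c

section Coded

variable {D ℓ : ℕ} {I : List (Fin (ℓ ^ D)) → Set (E D)}

lemma IsCoding.pairwiseDisjoint (hI : IsCoding I) (hℓ : 2 ≤ ℓ) {n : ℕ}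
    {T : Set (List (Fin (ℓ ^ D)))} (hT : ∀ w ∈ T, w.length = n) : T.PairwiseDisjoint I := by
  intro w hw w' hw' hne
  refine disjoint_left.2 fun x hx hx' => hne ?_
  exact hI.eq_of_mem hℓ ((hT w hw).trans (hT w' hw').symm) hx hx'

lemma IsCoding.measurableSet_biUnion (hI : IsCoding I) (T : Finset (List (Fin (ℓ ^ D)))) :
    MeasurableSet (⋃ w ∈ T, I w) :=
  T.measurableSet_biUnion fun w _ => hI.measurableSet w

lemma IsCoding.measureReal_biUnion (hI : IsCoding I) (hℓ : 2 ≤ ℓ) {n : ℕ} (m : Measure (E D))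
    [IsFiniteMeasure m] {T : Finset (List (Fin (ℓ ^ D)))} (hT : ∀ w ∈ T, w.length = n) :
    m.real (⋃ w ∈ T, I w) = ∑ w ∈ T, m.real (I w) :=
  measureReal_biUnion_finset (hI.pairwiseDisjoint hℓ hT) fun w _ => hI.measurableSet w

lemma IsCoding.sum_measureReal_append (hI : IsCoding I) (hℓ : 2 ≤ ℓ) (m : Measure (E D))
    [IsFiniteMeasure m] (u : List (Fin (ℓ ^ D))) (n : ℕ) :
    ∑ v ∈ words (Fin (ℓ ^ D)) n, m.real (I (u ++ v)) = m.real (I u) := by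
  have h : I u = ⋃ v ∈ words (Fin (ℓ ^ D)) n, I (u ++ v) := by
    refine Subset.antisymm (fun x hx => ?_) (iUnion₂_subset fun v _ => hI.append_subset u v)
    obtain ⟨v, hv, hxv⟩ := hI.exists_append_mem hℓ hx n
    exact mem_biUnion hv hxv
  rw [h, measureReal_biUnion_finset _ fun v _ => hI.measurableSet _]
  intro v hv v' hv' hne
  refine disjoint_left.2 fun x hx hx' => hne ?_
  rw [Finset.mem_coe, mem_words] at hv hv'
  exact List.append_cancel_left (hI.eq_of_mem hℓ (by simp [hv, hv']) hx hx')

lemma IsQuasiBernoulli.exists_isQuasiMultiplicative {m : Measure (E D)} (hm : IsQuasiBernoulli I m)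
    (hI : IsCoding I) (hℓ : 2 ≤ ℓ) :
    ∃ C, IsQuasiMultiplicative (fun w => m.real (I w)) C := by
  have := hm.isProbabilityMeasure
  obtain ⟨C, hC, h⟩ := hm.quasi
  refine ⟨C, hC, fun _ => measureReal_nonneg, ?_, hI.sum_measureReal_append hℓ m,
    fun u v => (h u v).1, fun u v => (h u v).2⟩
  rw [hI.nil_eq hℓ, measureReal_def, hm.measure_unitCube, ENNReal.toReal_one]

lemma IsCoding.partitionSum_eq (hI : IsCoding I) (hℓ : 2 ≤ ℓ) (m : Measure (E D)) (n : ℕ) (q : ℝ) :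
    partitionSum ℓ m n q = powSum (fun w => m.real (I w)) n q := by
  unfold partitionSum powSum
  have hinj : Function.Injective (cube (D := D) ℓ n) := by
    intro k k' hkk
    obtain ⟨w, hw, hwk⟩ := (hI.bijOn n).surjOn (mem_range_self k)
    obtain ⟨x, hx⟩ := hI.nonempty hℓ w
    rw [hwk] at hx
    have hx' := hx
    rw [hkk] at hx'
    funext i
    have := ((mem_cube_iff hℓ).1 hx i).symm.trans ((mem_cube_iff hℓ).1 hx' i)
    exact Fin.ext (by exact_mod_cast this)
  symm
  refine Finset.sum_bij' (fun w hw => ((hI.bijOn n).mapsTo (mem_words.1 hw)).choose)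
    (fun k _ => ((hI.bijOn n).surjOn (mem_range_self k)).choose) (fun _ _ => Finset.mem_univ _)
    (fun k _ => ?_) (fun w hw => ?_) (fun k _ => ?_) fun w hw => ?_
  · exact mem_words.2 ((hI.bijOn n).surjOn (mem_range_self k)).choose_spec.1
  · set k := ((hI.bijOn n).mapsTo (mem_words.1 hw)).choose with hk
    have hk' : cube ℓ n k = I w := ((hI.bijOn n).mapsTo (mem_words.1 hw)).choose_spec
    have h2 := ((hI.bijOn n).surjOn (mem_range_self k)).choose_spec
    exact (hI.bijOn n).injOn h2.1 (mem_words.1 hw) (h2.2.trans hk')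
  · have h2 := ((hI.bijOn n).surjOn (mem_range_self k)).choose_spec
    exact hinj (((hI.bijOn n).mapsTo h2.1).choose_spec.trans h2.2)
  · have hk' : cube ℓ n ((hI.bijOn n).mapsTo (mem_words.1 hw)).choose = I w :=
      ((hI.bijOn n).mapsTo (mem_words.1 hw)).choose_spec
    rw [hk']

lemma IsCoding.isSpectrum (hI : IsCoding I) (hℓ : 2 ≤ ℓ) {m : Measure (E D)} {C : ℝ}
    (hp : IsQuasiMultiplicative (fun w => m.real (I w)) C) :
    IsSpectrum (fun w => m.real (I w)) C ℓ (lqSpectrum ℓ m) := by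
  have := hp.isSpectrum (b := ℓ) (by exact_mod_cast hℓ)
  unfold lqSpectrum
  simpa only [hI.partitionSum_eq hℓ m] using this

variable {m : Measure (E D)} [IsProbabilityMeasure m]

lemma IsCoding.measure_compl_unitCube (hI : IsCoding I) (hℓ : 2 ≤ ℓ)
    (hcube : m (unitCube D) = 1) : m (unitCube D)ᶜ = 0 := by
  rw [← hI.nil_eq hℓ] at hcube ⊢
  exact (prob_compl_eq_zero_iff (hI.measurableSet [])).2 hcube

lemma IsCoding.measure_le_sum_of_meets (hI : IsCoding I) (hℓ : 2 ≤ ℓ)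
    (hcube : m (unitCube D) = 1) {n : ℕ} {S : Set (E D)} {T : Finset (List (Fin (ℓ ^ D)))}
    (hT : ∀ w ∈ words (Fin (ℓ ^ D)) n, (I w ∩ S).Nonempty → w ∈ T) :
    m S ≤ ENNReal.ofReal (∑ w ∈ T, m.real (I w)) := by
  have hnull := hI.measure_compl_unitCube hℓ hcube
  have hsub : S ⊆ (unitCube D)ᶜ ∪ ⋃ w ∈ T, I w := by
    intro x hx
    by_cases hxc : x ∈ unitCube D
    · obtain ⟨w, hw, hxw⟩ := hI.exists_mem hℓ hxc n
      exact Or.inr (mem_biUnion (hT w hw ⟨x, hxw, hx⟩) hxw)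
    · exact Or.inl hxc
  calc m S ≤ m (unitCube D)ᶜ + m (⋃ w ∈ T, I w) := (measure_mono hsub).trans (measure_union_le _ _)
    _ = m (⋃ w ∈ T, I w) := by rw [hnull, zero_add]
    _ ≤ ∑ w ∈ T, m (I w) := measure_biUnion_finset_le _ _
    _ = ENNReal.ofReal (∑ w ∈ T, m.real (I w)) := by
        rw [ENNReal.ofReal_sum_of_nonneg fun _ _ => measureReal_nonneg]
        exact Finset.sum_congr rfl fun w _ => (ofReal_measureReal).symm

lemma IsCoding.measure_le_of_forall_le (hI : IsCoding I) (hℓ : 2 ≤ ℓ)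
    (hcube : m (unitCube D) = 1) {n : ℕ} {U : Set (E D)}
    (hU : ∀ x ∈ U, ∀ y ∈ U, dist x y ≤ ((ℓ : ℝ) ^ n)⁻¹) {B : ℝ} (hB : 0 ≤ B)
    (h : ∀ w ∈ words (Fin (ℓ ^ D)) n, (I w ∩ U).Nonempty → m.real (I w) ≤ B) :
    m U ≤ ENNReal.ofReal (5 ^ D * B) := by
  classical
  set T := (words (Fin (ℓ ^ D)) n).filter fun w => (I w ∩ U).Nonempty with hT
  have hcard : T.card ≤ 5 ^ D := by
    refine hI.card_le_of_meets hℓ T (fun w hw => mem_words.1 (Finset.mem_filter.1 hw).1) hU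
      fun w hw => ?_
    exact (Finset.mem_filter.1 hw).2.mono (inter_subset_inter_left _ subset_closure)
  refine (hI.measure_le_sum_of_meets hℓ hcube (n := n) (T := T)
    fun w hw hne => Finset.mem_filter.2 ⟨hw, hne⟩).trans (ENNReal.ofReal_le_ofReal ?_)
  calc ∑ w ∈ T, m.real (I w) ≤ T.card • B :=
        Finset.sum_le_card_nsmul _ _ _ fun w hw =>
          h w (Finset.mem_filter.1 hw).1 (Finset.mem_filter.1 hw).2
    _ = T.card * B := by rw [nsmul_eq_mul]
    _ ≤ 5 ^ D * B := by
        refine mul_le_mul_of_nonneg_right ?_ hB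
        exact_mod_cast hcard

/-- A measurable set that occupies a fixed proportion of each cube has full measure. -/
lemma IsCoding.measure_compl_eq_zero (hI : IsCoding I) (hℓ : 2 ≤ ℓ) (hcube : m (unitCube D) = 1)
    {A : Set (E D)} (hA : MeasurableSet A) {c : ℝ} (hc : 0 < c)
    (h : ∀ u, c * m.real (I u) ≤ m.real (A ∩ I u)) : m Aᶜ = 0 := by
  classical
  have hnull := hI.measure_compl_unitCube hℓ hcube
  have hc1 : c ≤ 1 := by
    have h1 := h []
    have h2 : m.real (I []) = 1 := by
      rw [hI.nil_eq hℓ, measureReal_def, hcube, ENNReal.toReal_one]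
    rw [h2, mul_one] at h1
    exact h1.trans measureReal_le_one
  have hcompl : ∀ u, m.real (Aᶜ ∩ I u) ≤ (1 - c) * m.real (I u) := by
    intro u
    have := measureReal_inter_add_sdiff (μ := m) (s := I u) hA
    have e : I u \ A = Aᶜ ∩ I u := by rw [sdiff_eq, inter_comm]
    rw [e, inter_comm (I u)] at this
    linarith [h u]
  -- Up to a null set `U` is exhausted by disjoint cubes of a single generation, on each of which
  -- `Aᶜ` has proportion at most `1 - c`. Outer regularity then shrinks `U` to `Aᶜ`.
  have hopen : ∀ U, IsOpen U → Aᶜ ⊆ U → m.real Aᶜ ≤ (1 - c) * m.real U := by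
    intro U hU hAU
    set T : ℕ → Finset (List (Fin (ℓ ^ D))) := fun n =>
      (words (Fin (ℓ ^ D)) n).filter fun w => I w ⊆ U with hT
    set V : ℕ → Set (E D) := fun n => ⋃ w ∈ T n, I w with hV
    have hTl : ∀ n, ∀ w ∈ T n, w.length = n := fun n w hw =>
      mem_words.1 (Finset.mem_filter.1 hw).1
    have hVmono : Monotone V := by
      refine monotone_nat_of_le_succ fun n => iUnion₂_subset fun w hw x hx => ?_
      obtain ⟨v, hv, hxv⟩ := hI.exists_append_mem hℓ hx 1
      refine mem_biUnion (x := w ++ v) (Finset.mem_coe.2 (Finset.mem_filter.2 ⟨?_, ?_⟩)) hxv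
      · rw [mem_words] at hv ⊢
        rw [List.length_append, hv, hTl n w hw]
      · exact (hI.append_subset w v).trans (Finset.mem_filter.1 hw).2
    have hVcov : U ∩ unitCube D ⊆ ⋃ n, V n := by
      rintro x ⟨hxU, hxc⟩
      obtain ⟨ε, hε, hball⟩ := Metric.isOpen_iff.1 hU x hxU
      obtain ⟨n, hn⟩ := ((tendsto_mul_inv_pow hℓ ((D : ℝ) + 1)).eventually_lt_const hε).exists
      obtain ⟨w, hw, hxw⟩ := hI.exists_mem hℓ hxc n
      refine mem_iUnion.2 ⟨n, mem_biUnion (Finset.mem_coe.2 (Finset.mem_filter.2 ⟨hw, ?_⟩)) hxw⟩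
      intro y hy
      refine hball (Metric.mem_ball.2 (lt_of_le_of_lt ?_ hn))
      have := hI.dist_le_of_mem_closure (subset_closure hy) (subset_closure hxw)
      rwa [mem_words.1 hw] at this
    have hVle : ∀ n, m.real (Aᶜ ∩ V n) ≤ (1 - c) * m.real U := by
      intro n
      calc m.real (Aᶜ ∩ V n) = m.real (⋃ w ∈ T n, Aᶜ ∩ I w) := by
            rw [hV]; simp only [inter_iUnion]
        _ ≤ ∑ w ∈ T n, m.real (Aᶜ ∩ I w) := measureReal_biUnion_finset_le _ _
        _ ≤ ∑ w ∈ T n, (1 - c) * m.real (I w) := Finset.sum_le_sum fun w _ => hcompl w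
        _ = (1 - c) * m.real (V n) := by
            rw [← Finset.mul_sum, hI.measureReal_biUnion hℓ m (hTl n)]
        _ ≤ (1 - c) * m.real U := by
            refine mul_le_mul_of_nonneg_left (measureReal_mono ?_) (by linarith)
            exact iUnion₂_subset fun w hw => (Finset.mem_filter.1 hw).2
    have hlim : Tendsto (fun n => m.real (Aᶜ ∩ V n)) atTop (𝓝 (m.real (⋃ n, Aᶜ ∩ V n))) := by
      refine (ENNReal.tendsto_toReal (measure_ne_top _ _)).comp
        (tendsto_measure_iUnion_atTop fun n k hnk => ?_)
      exact inter_subset_inter_right _ (hVmono hnk)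
    refine le_trans ?_ (le_of_tendsto' hlim hVle)
    have hsub : Aᶜ ⊆ (⋃ n, Aᶜ ∩ V n) ∪ (unitCube D)ᶜ := by
      intro x hx
      by_cases hxc : x ∈ unitCube D
      · left
        rw [← inter_iUnion]
        exact ⟨hx, hVcov ⟨hAU hx, hxc⟩⟩
      · exact Or.inr hxc
    refine (measureReal_mono hsub).trans ((measureReal_union_le _ _).trans ?_)
    rw [measureReal_def m (unitCube D)ᶜ, hnull, ENNReal.toReal_zero, add_zero]
  have hfinal : m.real Aᶜ ≤ (1 - c) * m.real Aᶜ := by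
    refine le_of_forall_pos_le_add fun ε hε => ?_
    obtain ⟨U, hAU, hU, hlt⟩ := Aᶜ.exists_isOpen_lt_add (μ := m) (measure_ne_top _ _)
      (ENNReal.ofReal_pos.2 hε).ne'
    have h1 : m.real U ≤ m.real Aᶜ + ε := by
      have := ENNReal.toReal_mono (by finiteness) hlt.le
      rwa [ENNReal.toReal_add (by finiteness) (by finiteness), ENNReal.toReal_ofReal hε.le] at this
    have h2 := hopen U hU hAU
    have h3 := mul_le_mul_of_nonneg_left h1 (by linarith : (0 : ℝ) ≤ 1 - c)
    nlinarith
  have h0 : m.real Aᶜ = 0 := by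
    have := measureReal_nonneg (μ := m) (s := Aᶜ)
    nlinarith
  exact (measureReal_eq_zero_iff).1 h0

/-- The set of points that lie infinitely often in cubes with `m (I w) ≥ a ℓ ^ (-n s)` has
finite `s`-dimensional measure. -/
lemma IsCoding.hausdorffMeasure_limsup_le (hI : IsCoding I) (hℓ : 2 ≤ ℓ) {s a : ℝ} (hs : 0 ≤ s)
    (ha : 0 < a) :
    hausdorffMeasure s {x : E D | ∃ᶠ n : ℕ in atTop, ∃ w ∈ words (Fin (ℓ ^ D)) n, x ∈ I w ∧
      a * (ℓ : ℝ) ^ (-(n * s)) ≤ m.real (I w)} ≤ ENNReal.ofReal (((D : ℝ) + 1) ^ s / a) := by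
  classical
  have hℓ0 : (0 : ℝ) < ℓ := by positivity
  set good : List (Fin (ℓ ^ D)) → Prop := fun w =>
    a * (ℓ : ℝ) ^ (-(w.length * s)) ≤ m.real (I w) with hgood
  -- The maximal good cubes of generation at least `n`. They are disjoint, so their masses sum to at
  -- most `1`, and goodness converts mass into diameter to the power `s`.
  set ι : ℕ → Type := fun n => {w : List (Fin (ℓ ^ D)) // n ≤ w.length ∧ good w ∧
    ∀ w', n ≤ w'.length → w'.length < w.length → good w' → ¬ I w ⊆ I w'} with hι
  have hcount : ∀ n, Countable (ι n) := fun n => by rw [hι]; infer_instance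
  have hlim : Tendsto (fun n : ℕ => ENNReal.ofReal (((D : ℝ) + 1) * ((ℓ : ℝ) ^ n)⁻¹)) atTop
      (𝓝 0) := by
    simpa using ENNReal.tendsto_ofReal (tendsto_mul_inv_pow hℓ ((D : ℝ) + 1))
  have hdiam : ∀ w, Metric.ediam (I w) ≤ ENNReal.ofReal (((D : ℝ) + 1) * ((ℓ : ℝ) ^ w.length)⁻¹) :=
    fun w => (Metric.ediam_mono subset_closure).trans (hI.ediam_closure_le w)
  refine (hausdorffMeasure_le_liminf_tsum s _ _ hlim (fun n (w : ι n) => I w.1)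
    (Eventually.of_forall fun n w => ?_) (Eventually.of_forall fun n x hx => ?_)).trans ?_
  · refine (hdiam _).trans (ENNReal.ofReal_le_ofReal ?_)
    have : (1 : ℝ) ≤ ℓ := by exact_mod_cast (by omega : 1 ≤ ℓ)
    gcongr
    exact w.2.1
  · have hex : ∃ k, n ≤ k ∧ ∃ w ∈ words (Fin (ℓ ^ D)) k, x ∈ I w ∧ good w := by
      obtain ⟨k, hk, w, hw, hxw, hg⟩ := frequently_atTop.1 hx n
      refine ⟨k, hk, w, hw, hxw, ?_⟩
      simp only [hgood, mem_words.1 hw]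
      exact hg
    obtain ⟨hk, w, hw, hxw, hg⟩ := Nat.find_spec hex
    rw [mem_words] at hw
    refine mem_iUnion.2 ⟨⟨w, hw.symm ▸ hk, hg, fun w' hn hlt hg' hsub => ?_⟩, hxw⟩
    rw [hw] at hlt
    exact Nat.find_min hex hlt ⟨hn, w', mem_words.2 rfl, hsub hxw, hg'⟩
  · have hbound : ∀ n, ∑' w : ι n, Metric.ediam (I w.1) ^ s ≤
        ENNReal.ofReal (((D : ℝ) + 1) ^ s / a) := by
      intro n
      have hdisj : Pairwise (Function.onFun Disjoint fun w : ι n => I w.1) := by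
        intro w w' hne
        refine disjoint_left.2 fun x hx hx' => hne (Subtype.ext ?_)
        rcases lt_trichotomy w.1.length w'.1.length with hlt | heq | hlt
        · exact absurd (hI.subset_of_mem hℓ hlt.le hx hx')
            (w'.2.2.2 w.1 w.2.1 hlt w.2.2.1)
        · exact hI.eq_of_mem hℓ heq hx hx'
        · exact absurd (hI.subset_of_mem hℓ hlt.le hx' hx)
            (w.2.2.2 w'.1 w'.2.1 hlt w'.2.2.1)
      calc ∑' w : ι n, Metric.ediam (I w.1) ^ s
          ≤ ∑' w : ι n, ENNReal.ofReal (((D : ℝ) + 1) ^ s / a) * m (I w.1) := by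
            refine ENNReal.tsum_le_tsum fun w => ?_
            refine (ENNReal.rpow_le_rpow (hdiam _) hs).trans ?_
            rw [ENNReal.ofReal_rpow_of_nonneg (by positivity) hs, ← ofReal_measureReal,
              ← ENNReal.ofReal_mul (by positivity)]
            refine ENNReal.ofReal_le_ofReal ?_
            have hg : a * (ℓ : ℝ) ^ (-(w.1.length * s)) ≤ m.real (I w.1) := w.2.2.1
            have e : (((ℓ : ℝ) ^ w.1.length)⁻¹) ^ s = (ℓ : ℝ) ^ (-(w.1.length * s)) := by
              rw [Real.inv_rpow (by positivity), ← Real.rpow_natCast, ← Real.rpow_mul hℓ0.le,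
                Real.rpow_neg hℓ0.le]
            rw [Real.mul_rpow (by positivity) (by positivity), e, div_mul_eq_mul_div,
              le_div_iff₀ ha, mul_assoc, mul_comm _ a]
            gcongr
        _ = ENNReal.ofReal (((D : ℝ) + 1) ^ s / a) * m (⋃ w : ι n, I w.1) := by
            rw [ENNReal.tsum_mul_left, measure_iUnion hdisj fun w => hI.measurableSet _]
        _ ≤ ENNReal.ofReal (((D : ℝ) + 1) ^ s / a) * 1 := by gcongr; exact prob_le_one
        _ = _ := mul_one _
    exact (liminf_le_liminf (Eventually.of_forall hbound)).trans (by simp)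

end Coded

/-! ### Dimension of the measure -/

section Dimension

variable {D ℓ : ℕ} {I : List (Fin (ℓ ^ D)) → Set (E D)} {m : Measure (E D)}
  [IsProbabilityMeasure m]

lemma IsCoding.measurableSet_limsup (hI : IsCoding I) (T : ℕ → Finset (List (Fin (ℓ ^ D)))) :
    MeasurableSet (limsup (fun n => ⋃ w ∈ T n, I w) atTop) :=
  MeasurableSet.measurableSet_limsup fun n => hI.measurableSet_biUnion (T n)

lemma IsCoding.measure_limsup_eq_zero (hI : IsCoding I) (hℓ : 2 ≤ ℓ)
    {T : ℕ → Finset (List (Fin (ℓ ^ D)))} (hT : ∀ n, ∀ w ∈ T n, w.length = n) {A ρ : ℝ}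
    (hρ0 : 0 ≤ ρ) (hρ1 : ρ < 1) (h : ∀ n, ∑ w ∈ T n, m.real (I w) ≤ A * ρ ^ n) :
    m (limsup (fun n => ⋃ w ∈ T n, I w) atTop) = 0 := by
  refine measure_limsup_atTop_eq_zero ?_
  have hsum : Summable fun n => m.real (⋃ w ∈ T n, I w) := by
    refine Summable.of_nonneg_of_le (fun _ => measureReal_nonneg) (fun n => ?_)
      ((summable_geometric_of_lt_one hρ0 hρ1).mul_left A)
    rw [hI.measureReal_biUnion hℓ m (hT n)]
    exact h n
  have := hsum.tsum_ofReal_ne_top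
  simpa only [measureReal_def, ENNReal.ofReal_toReal (measure_ne_top m _)] using this

/-- By Borel-Cantelli, almost every point eventually avoids the cubes with `m (I w) ≥ ℓ ^ (-n s)` if
`s < d`, and those with `m (I w) ≤ ℓ ^ (-n s)` if `s > d`. The mass distribution principle uses the
first fact, `hausdorffMeasure_limsup_le` the second. -/
theorem IsSpectrum.hasDim (hI : IsCoding I) (hℓ : 2 ≤ ℓ) (hcube : m (unitCube D) = 1) {C : ℝ}
    (hp : IsQuasiMultiplicative (fun w => m.real (I w)) C) {τ : ℝ → ℝ}
    (hs : IsSpectrum (fun w => m.real (I w)) C ℓ τ) {d : ℝ≥0} (hd : HasDerivAt τ (-(d : ℝ)) 1) :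
    HasDim m d := by
  have hb : (1 : ℝ) < ℓ := by exact_mod_cast hℓ
  have hℓ0 : (0 : ℝ) < ℓ := by linarith
  have hlower : (d : ℝ≥0∞) ≤ lowerDim m := by
    refine le_iInf fun A => le_iInf fun hA => le_iInf fun hmA => ?_
    refine ENNReal.le_of_forall_nnreal_lt fun s hsd => ?_
    have hsd' : (s : ℝ) < d := by exact_mod_cast hsd
    obtain ⟨A', ρ, hρ0, hρ1, hle⟩ := hs.exists_sum_filter_ge_le hp hb hd hsd'
    set T : ℕ → Finset (List (Fin (ℓ ^ D))) := fun n =>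
      (words (Fin (ℓ ^ D)) n).filter fun w => (ℓ : ℝ) ^ (-(n * (s : ℝ))) ≤ m.real (I w) with hT
    set G : ℕ → Set (E D) := fun n => ⋃ w ∈ T n, I w with hG
    have hnull : m (limsup G atTop) = 0 := hI.measure_limsup_eq_zero hℓ
      (fun n w hw => mem_words.1 (Finset.mem_filter.1 hw).1) hρ0 hρ1 hle
    -- The mass distribution principle needs a starting generation independent of the point; some `S
    -- N` has positive mass.
    set S : ℕ → Set (E D) := fun N => A ∩ ⋂ n, ⋂ (_ : N ≤ n), (G n)ᶜ with hS
    have hSm : ∀ N, MeasurableSet (S N) := fun N =>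
      hA.inter (MeasurableSet.iInter fun n => MeasurableSet.iInter fun _ =>
        (hI.measurableSet_biUnion (T n)).compl)
    obtain ⟨N, hN⟩ : ∃ N, m (S N) ≠ 0 := by
      by_contra! hall
      have hsub : A ⊆ limsup G atTop ∪ ⋃ N, S N := by
        intro x hx
        by_cases hxl : x ∈ limsup G atTop
        · exact Or.inl hxl
        · rw [mem_limsup_iff_frequently_mem, not_frequently, eventually_atTop] at hxl
          obtain ⟨N, hN⟩ := hxl
          exact Or.inr (mem_iUnion.2 ⟨N, hx, mem_iInter₂.2 hN⟩)
      have : m A = 0 := measure_mono_null hsub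
        (measure_union_null hnull (measure_iUnion_null hall))
      exact hmA.ne' this
    have hle' : m.restrict (S N) ≤ ENNReal.ofReal (5 ^ D * (ℓ : ℝ) ^ (s : ℝ)) •
        (hausdorffMeasure (s : ℝ) : Measure (E D)) := by
      refine le_smul_hausdorffMeasure hb s.2 (by positivity) N fun n hn U hU => ?_
      rw [Measure.restrict_apply' (hSm N)]
      refine hI.measure_le_of_forall_le hℓ hcube (n := n)
        (fun x hx y hy => hU x hx.1 y hy.1) (Real.rpow_nonneg hℓ0.le _) ?_
      rintro w hw ⟨x, hxw, hxU, hxA, hxS⟩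
      by_contra! hlt
      exact mem_iInter₂.1 hxS n hn (mem_biUnion (Finset.mem_filter.2 ⟨hw, hlt.le⟩) hxw)
    have hne : hausdorffMeasure (s : ℝ) (S N) ≠ 0 := by
      intro h0
      have := hle' (S N)
      rw [Measure.restrict_apply_self, Measure.smul_apply, h0, smul_zero] at this
      exact hN (le_antisymm this zero_le)
    exact (le_dimH_of_hausdorffMeasure_ne_zero hne).trans (dimH_mono inter_subset_left)
  have hupper : upperDim m ≤ d := by
    have hex : ∀ j : ℕ, ∃ T : ℕ → Finset (List (Fin (ℓ ^ D))),
        (∀ n, ∀ w ∈ words (Fin (ℓ ^ D)) n, w ∉ T n →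
          (ℓ : ℝ) ^ (-(n * ((d : ℝ) + 1 / (j + 1)))) ≤ m.real (I w)) ∧
        m (limsup (fun n => ⋃ w ∈ T n, I w) atTop) = 0 := by
      intro j
      obtain ⟨A', ρ, hρ0, hρ1, hle⟩ := hs.exists_sum_filter_le_le hp hb hd
        (s := (d : ℝ) + 1 / (j + 1)) (by have : (0 : ℝ) < 1 / (j + 1) := by positivity
                                         linarith)
      refine ⟨fun n => (words (Fin (ℓ ^ D)) n).filter fun w =>
        m.real (I w) ≤ (ℓ : ℝ) ^ (-(n * ((d : ℝ) + 1 / (j + 1)))), fun n w hw hwT => ?_,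
        hI.measure_limsup_eq_zero hℓ
        (fun n w hw => mem_words.1 (Finset.mem_filter.1 hw).1) hρ0 hρ1 hle⟩
      by_contra! hlt
      exact hwT (Finset.mem_filter.2 ⟨hw, hlt.le⟩)
    choose T hT1 hT2 using hex
    -- Removing the exceptional sets of all exponents `d + 1 / (j + 1)` at once leaves one
    -- full-measure set of dimension at most `d`.
    set B : Set (E D) := ⋃ j, limsup (fun n => ⋃ w ∈ T j n, I w) atTop with hB
    have hBm : MeasurableSet B := MeasurableSet.iUnion fun j => hI.measurableSet_limsup (T j)
    have hB0 : m B = 0 := measure_iUnion_null hT2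
    have hUm : MeasurableSet (unitCube D) := hI.nil_eq hℓ ▸ hI.measurableSet []
    have hF1 : m (unitCube D \ B) = 1 := by rw [measure_sdiff_null hB0, hcube]
    refine (iInf_le_of_le (unitCube D \ B) (iInf₂_le (hUm.diff hBm) hF1)).trans ?_
    have hdim : ∀ j : ℕ, dimH (unitCube D \ B) ≤ ((d + 1 / ((j : ℝ≥0) + 1) : ℝ≥0) : ℝ≥0∞) := by
      intro j
      refine dimH_le_of_hausdorffMeasure_ne_top (ne_top_of_le_ne_top ENNReal.ofReal_ne_top
        ((measure_mono ?_).trans (hI.hausdorffMeasure_limsup_le (m := m) hℓ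
          (s := ((d + 1 / ((j : ℝ≥0) + 1) : ℝ≥0) : ℝ)) (NNReal.coe_nonneg _) one_pos)))
      rintro x ⟨hxU, hxB⟩
      have hxl : x ∉ limsup (fun n => ⋃ w ∈ T j n, I w) atTop := fun h => hxB (mem_iUnion.2 ⟨j, h⟩)
      rw [mem_limsup_iff_frequently_mem, not_frequently] at hxl
      refine (hxl.mono fun n hn => ?_).frequently
      obtain ⟨w, hw, hxw⟩ := hI.exists_mem hℓ hxU n
      refine ⟨w, hw, hxw, ?_⟩
      rw [one_mul]
      have := hT1 j n w hw fun hwT => hn (mem_biUnion hwT hxw)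
      push_cast
      exact this
    have hlim : Tendsto (fun j : ℕ => ((d + 1 / ((j : ℝ≥0) + 1) : ℝ≥0) : ℝ≥0∞)) atTop
        (𝓝 (d : ℝ≥0∞)) := by
      rw [ENNReal.tendsto_coe]
      have : Tendsto (fun j : ℕ => 1 / ((j : ℝ≥0) + 1)) atTop (𝓝 0) :=
        tendsto_one_div_add_atTop_nhds_zero_nat
      simpa using this.const_add d
    exact ge_of_tendsto' hlim hdim
  have hmid : lowerDim m ≤ upperDim m := by
    refine le_iInf fun A => le_iInf fun hA => le_iInf fun hmA => ?_
    exact iInf_le_of_le A (iInf₂_le hA (by rw [hmA]; exact one_pos))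
  exact ⟨le_antisymm (hmid.trans hupper) hlower, le_antisymm hupper (hlower.trans hmid)⟩

/-! ### Fluctuations -/

lemma IsCoding.le_measureReal_limsup_inter (hI : IsCoding I) (hℓ : 2 ≤ ℓ)
    (T : ℕ → Finset (List (Fin (ℓ ^ D)))) (u : List (Fin (ℓ ^ D))) {c : ℝ}
    (h : ∀ N, ∃ n ≥ N, ∃ V ⊆ words (Fin (ℓ ^ D)) n, (∀ v ∈ V, u ++ v ∈ T (u.length + n)) ∧
      c ≤ ∑ v ∈ V, m.real (I (u ++ v))) :
    c ≤ m.real (limsup (fun n => ⋃ w ∈ T n, I w) atTop ∩ I u) := by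
  have key : ENNReal.ofReal c ≤ (m.restrict (I u)) (limsup (fun n => ⋃ w ∈ T n, I w) atTop) := by
    refine le_measure_limsup (fun n => hI.measurableSet_biUnion (T n))
      (frequently_atTop.2 fun N => ?_)
    obtain ⟨n, hn, V, hV, hVT, hc⟩ := h N
    refine ⟨u.length + n, by omega, ?_⟩
    rw [Measure.restrict_apply (hI.measurableSet_biUnion _)]
    have hdisj : (V : Set (List (Fin (ℓ ^ D)))).PairwiseDisjoint fun v => I (u ++ v) := by
      intro v hv v' hv' hne
      refine disjoint_left.2 fun x hx hx' => hne ?_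
      have h1 := mem_words.1 (hV hv)
      have h2 := mem_words.1 (hV hv')
      exact List.append_cancel_left (hI.eq_of_mem hℓ (by simp [h1, h2]) hx hx')
    calc ENNReal.ofReal c ≤ ENNReal.ofReal (m.real (⋃ v ∈ V, I (u ++ v))) := by
          rw [measureReal_biUnion_finset hdisj fun v _ => hI.measurableSet _]
          exact ENNReal.ofReal_le_ofReal hc
      _ = m (⋃ v ∈ V, I (u ++ v)) := ofReal_measureReal (measure_ne_top _ _)
      _ ≤ _ := measure_mono (iUnion₂_subset fun v hv => subset_inter
          (subset_biUnion_of_mem (u := I) (Finset.mem_coe.2 (hVT v hv))) (hI.append_subset u v))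
  rw [Measure.restrict_apply (hI.measurableSet_limsup T)] at key
  exact (ENNReal.ofReal_le_iff_le_toReal (measure_ne_top _ _)).1 key

/-- The points lying infinitely often in cubes with `m (I w) ≥ (j + 1) ℓ ^ (-n d)` have full
measure, by fluctuation inside every cube, while their Hausdorff measure is `O(1 / (j + 1))`. The
intersection over `j` separates the two measures. -/
theorem IsCoding.mutuallySingular_hausdorffMeasure (hI : IsCoding I) (hℓ : 2 ≤ ℓ)
    (hcube : m (unitCube D) = 1) {C : ℝ} (hp : IsQuasiMultiplicative (fun w => m.real (I w)) C)
    {d : ℝ} (hd : 0 ≤ d)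
    (h : ∃ c > 0, ∀ K > 0, ∀ N : ℕ, ∃ n ≥ N,
      c ≤ ∑ w ∈ words (Fin (ℓ ^ D)) n with K * (ℓ : ℝ) ^ (-(n * d)) ≤ m.real (I w),
        m.real (I w)) :
    m ⟂ₘ hausdorffMeasure d := by
  have hℓ0 : (0 : ℝ) < ℓ := by positivity
  obtain ⟨c, hc, H⟩ := h
  have hC := hp.C_pos
  set T : ℕ → ℕ → Finset (List (Fin (ℓ ^ D))) := fun j n => (words (Fin (ℓ ^ D)) n).filter
    fun w => ((j : ℝ) + 1) * (ℓ : ℝ) ^ (-(n * d)) ≤ m.real (I w) with hT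
  set F : ℕ → Set (E D) := fun j => limsup (fun n => ⋃ w ∈ T j n, I w) atTop with hF
  have hFm : ∀ j, MeasurableSet (F j) := fun j => hI.measurableSet_limsup (T j)
  have hfull : ∀ j, m (F j)ᶜ = 0 := by
    intro j
    refine hI.measure_compl_eq_zero hℓ hcube (hFm j) (c := c / C) (by positivity) fun u => ?_
    by_cases hu0 : m.real (I u) = 0
    · rw [hu0, mul_zero]; exact measureReal_nonneg
    have hu : 0 < m.real (I u) := hp.pos_of_ne hu0
    refine hI.le_measureReal_limsup_inter hℓ (T j) u fun N => ?_
    have hlu : 0 < (ℓ : ℝ) ^ (-(u.length * d)) := Real.rpow_pos_of_pos hℓ0 _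
    -- This `K` compensates the factor `m (I u) / C` lost in passing from `v` to `u ++ v`; the
    -- fluctuation probability `c` does not depend on it.
    obtain ⟨n, hn, hsum⟩ := H (((j : ℝ) + 1) * C * (ℓ : ℝ) ^ (-(u.length * d)) / m.real (I u))
      (by positivity) N
    refine ⟨n, hn, (words (Fin (ℓ ^ D)) n).filter fun w =>
        ((j : ℝ) + 1) * C * (ℓ : ℝ) ^ (-(u.length * d)) / m.real (I u) *
          (ℓ : ℝ) ^ (-(n * d)) ≤ m.real (I w), Finset.filter_subset _ _, fun v hv => ?_, ?_⟩
    · obtain ⟨hv1, hv2⟩ := Finset.mem_filter.1 hv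
      refine Finset.mem_filter.2 ⟨by simpa using mem_words.1 hv1, ?_⟩
      refine le_trans ?_ (hp.lower u v)
      have e : (ℓ : ℝ) ^ (-(((u.length + n : ℕ) : ℝ) * d)) =
          (ℓ : ℝ) ^ (-(u.length * d)) * (ℓ : ℝ) ^ (-(n * d)) := by
        rw [← Real.rpow_add hℓ0]; push_cast; ring_nf
      rw [e, one_div_mul_eq_div, le_div_iff₀ hC]
      rw [div_mul_eq_mul_div, div_le_iff₀ hu] at hv2
      nlinarith
    · calc c / C * m.real (I u) = 1 / C * m.real (I u) * c := by ring
        _ ≤ 1 / C * m.real (I u) * _ := mul_le_mul_of_nonneg_left hsum (by positivity)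
        _ ≤ _ := by
            rw [Finset.mul_sum]
            refine Finset.sum_le_sum fun v _ => ?_
            rw [mul_assoc]
            exact hp.lower u v
  refine ⟨(⋂ j, F j)ᶜ, (MeasurableSet.iInter hFm).compl, ?_, ?_⟩
  · rw [compl_iInter]
    exact measure_iUnion_null hfull
  · rw [compl_compl]
    have hle : ∀ j : ℕ, hausdorffMeasure d (⋂ j, F j) ≤
        ENNReal.ofReal (((D : ℝ) + 1) ^ d / ((j : ℝ) + 1)) := by
      intro j
      refine (measure_mono ((iInter_subset F j).trans fun x hx => ?_)).trans
        (hI.hausdorffMeasure_limsup_le (m := m) hℓ hd (by positivity))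
      refine (mem_limsup_iff_frequently_mem.1 hx).mono fun n hn => ?_
      obtain ⟨w, hw, hxw⟩ := mem_iUnion₂.1 hn
      exact ⟨w, (Finset.mem_filter.1 hw).1, hxw, (Finset.mem_filter.1 hw).2⟩
    have hlim : Tendsto (fun j : ℕ => ENNReal.ofReal (((D : ℝ) + 1) ^ d / ((j : ℝ) + 1))) atTop
        (𝓝 0) := by
      have := (tendsto_one_div_add_atTop_nhds_zero_nat (𝕜 := ℝ)).const_mul (((D : ℝ) + 1) ^ d)
      simpa [div_eq_mul_inv] using ENNReal.tendsto_ofReal this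
    exact le_antisymm (ge_of_tendsto' hlim hle) zero_le

/-- The mass of the cubes near `I w`. -/
def neighbourMass (I : List (Fin (ℓ ^ D)) → Set (E D)) (m : Measure (E D))
    (w : List (Fin (ℓ ^ D))) : ℝ :=
  ∑ w' ∈ neighbours I w, m.real (I w')

/-- Double counting: being neighbours is symmetric, so each cube is counted at most `5 ^ D` times.
-/
lemma IsCoding.sum_neighbourMass_le (hI : IsCoding I) (hℓ : 2 ≤ ℓ) (n : ℕ) :
    ∑ w ∈ words (Fin (ℓ ^ D)) n, neighbourMass I m w ≤ 5 ^ D := by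
  have hsum : ∑ w ∈ words (Fin (ℓ ^ D)) n, m.real (I w) ≤ 1 := by
    rw [← hI.measureReal_biUnion hℓ m fun w hw => mem_words.1 hw]
    exact measureReal_le_one
  unfold neighbourMass
  rw [Finset.sum_comm' (t' := words (Fin (ℓ ^ D)) n) (s' := neighbours I)]
  · calc ∑ w ∈ words (Fin (ℓ ^ D)) n, ∑ _w' ∈ neighbours I w, m.real (I w)
        ≤ ∑ w ∈ words (Fin (ℓ ^ D)) n, 5 ^ D * m.real (I w) := by
          refine Finset.sum_le_sum fun w _ => ?_
          rw [Finset.sum_const, nsmul_eq_mul]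
          refine mul_le_mul_of_nonneg_right ?_ measureReal_nonneg
          exact_mod_cast hI.card_neighbours_le hℓ w
      _ ≤ 5 ^ D := by
          rw [← Finset.mul_sum]
          exact mul_le_of_le_one_right (by positivity) hsum
  · intro w w'
    rw [mem_neighbours_comm (w := w) (w' := w')]
    constructor
    · rintro ⟨h1, h2⟩
      refine ⟨h2, ?_⟩
      rw [mem_words] at h1 ⊢
      rw [← (mem_neighbours.1 h2).1, h1]
    · rintro ⟨h1, h2⟩
      refine ⟨?_, h1⟩
      rw [mem_words] at h2 ⊢
      rw [(mem_neighbours.1 h1).1, h2]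

lemma IsCoding.measure_closedBall_le (hI : IsCoding I) (hℓ : 2 ≤ ℓ) (hcube : m (unitCube D) = 1)
    {w : List (Fin (ℓ ^ D))} {x : E D} (hx : x ∈ I w) :
    m (Metric.closedBall x ((ℓ : ℝ) ^ w.length)⁻¹) ≤ ENNReal.ofReal (neighbourMass I m w) := by
  refine hI.measure_le_sum_of_meets hℓ hcube (n := w.length) ?_
  rintro w' hw' ⟨y, hy, hyx⟩
  refine mem_neighbours.2 ⟨mem_words.1 hw', x, hx, y, hy, ?_⟩
  rw [dist_comm]
  exact hyx

/-- The cubes whose neighbourhood has mass much larger than their own carry little mass. -/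
lemma IsCoding.sum_filter_neighbourMass_le (hI : IsCoding I) (hℓ : 2 ≤ ℓ) {R : ℝ} (hR : 0 < R)
    (n : ℕ) :
    ∑ w ∈ words (Fin (ℓ ^ D)) n with R * m.real (I w) < neighbourMass I m w, m.real (I w) ≤
      5 ^ D / R := by
  have hnn : ∀ w, 0 ≤ neighbourMass I m w := fun w =>
    Finset.sum_nonneg fun _ _ => measureReal_nonneg
  rw [le_div_iff₀ hR, Finset.sum_mul]
  refine le_trans ?_ (hI.sum_neighbourMass_le (m := m) hℓ n)
  refine (Finset.sum_le_sum fun w hw => ?_).trans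
    (Finset.sum_le_sum_of_subset_of_nonneg (Finset.filter_subset _ _) fun w _ _ => hnn w)
  rw [mul_comm]
  exact (Finset.mem_filter.1 hw).2.le

/-- Packing estimates need balls of small mass, and a light cube may have heavy neighbours. Such
cubes carry little mass, so discarding them leaves half of the fluctuation;
`measure_le_packingOuter` then applies. -/
theorem IsCoding.absolutelyContinuous_packingMeasure (hI : IsCoding I) (hℓ : 2 ≤ ℓ)
    (hcube : m (unitCube D) = 1) {C : ℝ} (hp : IsQuasiMultiplicative (fun w => m.real (I w)) C)
    {d : ℝ}
    (h : ∃ c > 0, ∀ K > 0, ∀ N : ℕ, ∃ n ≥ N,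
      c ≤ ∑ w ∈ words (Fin (ℓ ^ D)) n with m.real (I w) ≤ K * (ℓ : ℝ) ^ (-(n * d)),
        m.real (I w)) :
    m ≪ packingMeasure d := by
  classical
  have hb : (1 : ℝ) < ℓ := by exact_mod_cast hℓ
  have hℓ0 : (0 : ℝ) < ℓ := by positivity
  obtain ⟨c, hc, H⟩ := h
  have hC := hp.C_pos
  set T : ℕ → ℕ → Finset (List (Fin (ℓ ^ D))) := fun j n => (words (Fin (ℓ ^ D)) n).filter
    fun w => neighbourMass I m w ≤ ((j : ℝ) + 1) * (ℓ : ℝ) ^ (-(n * d)) with hT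
  set F : ℕ → Set (E D) := fun j => limsup (fun n => ⋃ w ∈ T j n, I w) atTop with hF
  have hFm : ∀ j, MeasurableSet (F j) := fun j => hI.measurableSet_limsup (T j)
  have hfull : m (⋃ j, F j)ᶜ = 0 := by
    refine hI.measure_compl_eq_zero hℓ hcube (MeasurableSet.iUnion hFm) (c := c / (2 * C))
      (by positivity) fun u => ?_
    by_cases hu0 : m.real (I u) = 0
    · rw [hu0, mul_zero]; exact measureReal_nonneg
    have hu : 0 < m.real (I u) := hp.pos_of_ne hu0
    -- Chosen so that the discarded mass `5 ^ D / R` is half of `c / C * m (I u)`.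
    set R : ℝ := 2 * 5 ^ D * C / (c * m.real (I u)) with hR
    have hR0 : 0 < R := by positivity
    -- The index depends on `u`, so the full-measure set is the union of the `F j`.
    obtain ⟨j, hj⟩ := exists_nat_ge (R * (C * (ℓ : ℝ) ^ (u.length * d)))
    refine le_trans ?_ (measureReal_mono (inter_subset_inter_left _ (subset_iUnion F j)))
    refine hI.le_measureReal_limsup_inter hℓ (T j) u fun N => ?_
    obtain ⟨n, hn, hsum⟩ := H 1 one_pos N
    set V := (words (Fin (ℓ ^ D)) n).filter fun v =>
      m.real (I v) ≤ 1 * (ℓ : ℝ) ^ (-(n * d)) with hV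
    refine ⟨n, hn, V.filter fun v => ¬ R * m.real (I (u ++ v)) < neighbourMass I m (u ++ v),
      (Finset.filter_subset _ _).trans (Finset.filter_subset _ _), fun v hv => ?_, ?_⟩
    · obtain ⟨hvV, hv3⟩ := Finset.mem_filter.1 hv
      obtain ⟨hv1, hv2⟩ := Finset.mem_filter.1 hvV
      refine Finset.mem_filter.2 ⟨by simpa using mem_words.1 hv1, (not_lt.1 hv3).trans ?_⟩
      have e : (ℓ : ℝ) ^ (-(n * d)) =
          (ℓ : ℝ) ^ (u.length * d) * (ℓ : ℝ) ^ (-(((u.length + n : ℕ) : ℝ) * d)) := by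
        rw [← Real.rpow_add hℓ0]; push_cast; ring_nf
      have hpos : 0 < (ℓ : ℝ) ^ (-(((u.length + n : ℕ) : ℝ) * d)) := Real.rpow_pos_of_pos hℓ0 _
      rw [one_mul, e] at hv2
      calc R * m.real (I (u ++ v)) ≤ R * (C * (m.real (I u) * m.real (I v))) :=
            mul_le_mul_of_nonneg_left (hp.upper u v) hR0.le
        _ ≤ R * (C * (1 * ((ℓ : ℝ) ^ (u.length * d) *
              (ℓ : ℝ) ^ (-(((u.length + n : ℕ) : ℝ) * d))))) := by
            gcongr
            exact measureReal_le_one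
        _ = R * (C * (ℓ : ℝ) ^ (u.length * d)) * (ℓ : ℝ) ^ (-(((u.length + n : ℕ) : ℝ) * d)) := by
            ring
        _ ≤ ((j : ℝ) + 1) * (ℓ : ℝ) ^ (-(((u.length + n : ℕ) : ℝ) * d)) := by
            refine mul_le_mul_of_nonneg_right ?_ hpos.le
            linarith
    · have h1 : c / C * m.real (I u) ≤ ∑ v ∈ V, m.real (I (u ++ v)) := by
        calc c / C * m.real (I u) = 1 / C * m.real (I u) * c := by ring
          _ ≤ 1 / C * m.real (I u) * ∑ v ∈ V, m.real (I v) :=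
              mul_le_mul_of_nonneg_left hsum (by positivity)
          _ ≤ _ := by
              rw [Finset.mul_sum]
              refine Finset.sum_le_sum fun v _ => ?_
              rw [mul_assoc]
              exact hp.lower u v
      have h2 : ∑ v ∈ V with R * m.real (I (u ++ v)) < neighbourMass I m (u ++ v),
          m.real (I (u ++ v)) ≤ 5 ^ D / R := by
        refine le_trans ?_ (hI.sum_filter_neighbourMass_le (m := m) hℓ hR0 (u.length + n))
        rw [Finset.sum_filter (s := V), Finset.sum_filter (s := words (Fin (ℓ ^ D)) (u.length + n)),
          sum_words_add]
        set f : List (Fin (ℓ ^ D)) → ℝ := fun w =>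
          if R * m.real (I w) < neighbourMass I m w then m.real (I w) else 0 with hf
        have hf0 : ∀ w, 0 ≤ f w := fun w => by
          simp only [hf]; split_ifs
          · exact measureReal_nonneg
          · exact le_rfl
        calc ∑ v ∈ V, f (u ++ v) ≤ ∑ v ∈ words (Fin (ℓ ^ D)) n, f (u ++ v) :=
              Finset.sum_le_sum_of_subset_of_nonneg (Finset.filter_subset _ _) fun _ _ _ => hf0 _
          _ ≤ _ := Finset.single_le_sum (f := fun u => ∑ v ∈ words (Fin (ℓ ^ D)) n, f (u ++ v))
              (fun _ _ => Finset.sum_nonneg fun _ _ => hf0 _) (mem_words.2 rfl)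
      have h3 := Finset.sum_filter_add_sum_filter_not V
        (fun v => R * m.real (I (u ++ v)) < neighbourMass I m (u ++ v))
        (fun v => m.real (I (u ++ v)))
      have h4 : (5 : ℝ) ^ D / R = c / (2 * C) * m.real (I u) := by
        rw [hR]; field_simp
      have h5 : c / C * m.real (I u) = c / (2 * C) * m.real (I u) + c / (2 * C) * m.real (I u) := by
        field_simp; ring
      linarith
  refine AbsolutelyContinuous.mk fun A hA hA0 => ?_
  have hA0' : packingOuter d A = 0 := by
    unfold packingMeasure at hA0
    rwa [toMeasure_apply _ _ hA] at hA0
  have hpiece : ∀ j, m (A ∩ F j) = 0 := by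
    intro j
    have hle := measure_le_packingOuter (μ := m) (A := A ∩ F j) (s := d) (K := (j : ℝ) + 1) hb
      (by positivity) fun x hx => ?_
    · have h0 : packingOuter d (A ∩ F j) = 0 :=
        le_antisymm (hA0' ▸ (packingOuter d).mono inter_subset_left) zero_le
      rw [h0, mul_zero] at hle
      exact le_antisymm hle zero_le
    · refine (mem_limsup_iff_frequently_mem.1 hx.2).mono fun n hn => ?_
      obtain ⟨w, hw, hxw⟩ := mem_iUnion₂.1 hn
      obtain ⟨hw1, hw2⟩ := Finset.mem_filter.1 hw
      have := hI.measure_closedBall_le hℓ hcube hxw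
      rw [mem_words.1 hw1] at this
      exact this.trans (ENNReal.ofReal_le_ofReal hw2)
  have hsub : A ⊆ (⋃ j, A ∩ F j) ∪ (⋃ j, F j)ᶜ := by
    intro x hx
    by_cases hxF : x ∈ ⋃ j, F j
    · left
      rw [← inter_iUnion]
      exact ⟨hx, hxF⟩
    · exact Or.inr hxF
  exact measure_mono_null hsub (measure_union_null (measure_iUnion_null hpiece) hfull)

end Dimension

/-! ### The support -/

section Support

variable {D ℓ : ℕ} {I : List (Fin (ℓ ^ D)) → Set (E D)} {m : Measure (E D)}
  [IsProbabilityMeasure m]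

open Classical in
/-- The words of length `n` whose cubes are charged by `m`. -/
def chargedWords (I : List (Fin (ℓ ^ D)) → Set (E D)) (m : Measure (E D)) (n : ℕ) :
    Finset (List (Fin (ℓ ^ D))) :=
  (words (Fin (ℓ ^ D)) n).filter fun w => m.real (I w) ≠ 0

omit [IsProbabilityMeasure m] in
lemma mem_chargedWords {n : ℕ} {w : List (Fin (ℓ ^ D))} :
    w ∈ chargedWords I m n ↔ w.length = n ∧ m.real (I w) ≠ 0 := by
  simp [chargedWords]

omit [IsProbabilityMeasure m] in
lemma card_chargedWords (n : ℕ) :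
    ((chargedWords I m n).card : ℝ) = powSum (fun w => m.real (I w)) n 0 := by
  classical
  unfold chargedWords powSum
  rw [Finset.card_filter]
  push_cast
  refine Finset.sum_congr rfl fun w _ => ?_
  by_cases h : m.real (I w) = 0 <;> simp [h]

/-- The finitely many closed charged cubes of a generation form a closed set of full measure, which
therefore contains the support. -/
lemma IsCoding.exists_mem_closure_of_mem_support (hI : IsCoding I) (hℓ : 2 ≤ ℓ)
    (hcube : m (unitCube D) = 1) {x : E D} (hx : x ∈ m.support) (n : ℕ) :
    ∃ w ∈ chargedWords I m n, x ∈ closure (I w) := by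
  have hclosed : IsClosed (⋃ w ∈ chargedWords I m n, closure (I w)) :=
    (Finset.finite_toSet _).isClosed_biUnion fun w _ => isClosed_closure
  have hae : (⋃ w ∈ chargedWords I m n, closure (I w)) ∈ ae m := by
    rw [mem_ae_iff]
    have hsub : (⋃ w ∈ chargedWords I m n, closure (I w))ᶜ ⊆
        (unitCube D)ᶜ ∪ ⋃ w ∈ {w | m (I w) = 0}, I w := by
      intro y hy
      by_cases hyc : y ∈ unitCube D
      · right
        obtain ⟨w, hw, hyw⟩ := hI.exists_mem hℓ hyc n
        refine mem_biUnion ?_ hyw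
        by_contra hne
        refine hy (mem_biUnion (mem_chargedWords.2 ⟨mem_words.1 hw, fun h0 => hne ?_⟩)
          (subset_closure hyw))
        exact (measureReal_eq_zero_iff).1 h0
      · exact Or.inl hyc
    refine measure_mono_null hsub (measure_union_null (hI.measure_compl_unitCube hℓ hcube) ?_)
    exact (measure_biUnion_null_iff (to_countable _)).2 fun w hw => hw
  obtain ⟨w, hw, hxw⟩ := mem_iUnion₂.1 (support_subset_of_isClosed hclosed hae hx)
  exact ⟨w, hw, hxw⟩

lemma IsCoding.ediam_closure_rpow_le (hI : IsCoding I) (hℓ : 2 ≤ ℓ) {s : ℝ} (hs : 0 ≤ s)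
    (w : List (Fin (ℓ ^ D))) :
    Metric.ediam (closure (I w)) ^ s ≤
      ENNReal.ofReal (((D : ℝ) + 1) ^ s * (ℓ : ℝ) ^ (-(w.length * s))) := by
  have hℓ0 : (0 : ℝ) < ℓ := by positivity
  refine (ENNReal.rpow_le_rpow (hI.ediam_closure_le w) hs).trans (le_of_eq ?_)
  rw [ENNReal.ofReal_rpow_of_nonneg (by positivity) hs,
    Real.mul_rpow (by positivity) (by positivity), Real.inv_rpow (by positivity),
    ← Real.rpow_natCast, ← Real.rpow_mul hℓ0.le, Real.rpow_neg hℓ0.le]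

omit [IsProbabilityMeasure m] in
/-- A covering bound for sets covered by closed charged cubes of every large generation. -/
lemma IsCoding.hausdorffMeasure_le_of_cover (hI : IsCoding I) (hℓ : 2 ≤ ℓ) {s B : ℝ} (hs : 0 ≤ s)
    {S : Set (E D)} {T : ℕ → Finset (List (Fin (ℓ ^ D)))} (hT : ∀ n, ∀ w ∈ T n, w.length = n)
    (hcov : ∀ᶠ n in atTop, S ⊆ ⋃ w ∈ T n, closure (I w))
    (hB : ∀ n, (T n).card * (ℓ : ℝ) ^ (-(n * s)) ≤ B) :
    hausdorffMeasure s S ≤ ENNReal.ofReal (((D : ℝ) + 1) ^ s * B) := by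
  have hlim : Tendsto (fun n : ℕ => ENNReal.ofReal (((D : ℝ) + 1) * ((ℓ : ℝ) ^ n)⁻¹)) atTop
      (𝓝 0) := by
    simpa using ENNReal.tendsto_ofReal (tendsto_mul_inv_pow hℓ ((D : ℝ) + 1))
  refine (hausdorffMeasure_le_liminf_sum s S _ hlim (fun n (w : T n) => closure (I w.1))
    (Eventually.of_forall fun n w => ?_) (hcov.mono fun n hn => ?_)).trans ?_
  · have := hI.ediam_closure_le w.1
    rwa [hT n w.1 w.2] at this
  · rwa [← iUnion_subtype (fun w => w ∈ T n) fun w => closure (I w.1)] at hn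
  · have hbound : ∀ n, ∑ w : T n, Metric.ediam (closure (I w.1)) ^ s ≤
        ENNReal.ofReal (((D : ℝ) + 1) ^ s * B) := by
      intro n
      calc ∑ w : T n, Metric.ediam (closure (I w.1)) ^ s
          ≤ ∑ _w : T n, ENNReal.ofReal (((D : ℝ) + 1) ^ s * (ℓ : ℝ) ^ (-(n * s))) := by
            refine Finset.sum_le_sum fun w _ => ?_
            have := hI.ediam_closure_rpow_le hℓ hs w.1
            rwa [hT n w.1 w.2] at this
        _ = ENNReal.ofReal (((D : ℝ) + 1) ^ s * ((T n).card * (ℓ : ℝ) ^ (-(n * s)))) := by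
            rw [Finset.sum_const, nsmul_eq_mul, Finset.card_univ, Fintype.card_coe,
              ← ENNReal.ofReal_natCast, ← ENNReal.ofReal_mul (by positivity)]
            ring_nf
        _ ≤ _ := ENNReal.ofReal_le_ofReal (mul_le_mul_of_nonneg_left (hB n) (by positivity))
    exact (liminf_le_liminf (Eventually.of_forall hbound)).trans (by simp)

lemma IsSpectrum.dimH_support_le (hI : IsCoding I) (hℓ : 2 ≤ ℓ) (hcube : m (unitCube D) = 1)
    {C : ℝ} (hp : IsQuasiMultiplicative (fun w => m.real (I w)) C) {τ : ℝ → ℝ}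
    (hs : IsSpectrum (fun w => m.real (I w)) C ℓ τ) {δ : ℝ≥0} (hδ : (δ : ℝ) = τ 0) :
    dimH m.support ≤ δ := by
  have hb : (1 : ℝ) < ℓ := by exact_mod_cast hℓ
  have hℓ0 : (0 : ℝ) < ℓ := by linarith
  refine dimH_le_of_hausdorffMeasure_ne_top (ne_top_of_le_ne_top ENNReal.ofReal_ne_top
    (hI.hausdorffMeasure_le_of_cover hℓ δ.2 (T := chargedWords I m) (B := 1)
      (fun n w hw => (mem_chargedWords.1 hw).1) (Eventually.of_forall fun n x hx => ?_)
      fun n => ?_))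
  · obtain ⟨w, hw, hxw⟩ := hI.exists_mem_closure_of_mem_support hℓ hcube hx n
    exact mem_biUnion hw hxw
  · rw [card_chargedWords, hs.powSum_zero hp hb, ← hδ, ← Real.rpow_add hℓ0]
    simp

/-! ### The uniform measure on the support -/

/-- The word formed by the first `n` letters of a sequence. -/
def prefixWord {α : Type*} {P : α → Prop} (n : ℕ) (ω : ℕ → {a : α // P a}) : List α :=
  List.ofFn fun i : Fin n => (ω i).1

lemma length_prefixWord {α : Type*} {P : α → Prop} (n : ℕ) (ω : ℕ → {a : α // P a}) :
    (prefixWord n ω).length = n := by simp [prefixWord]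

lemma prefixWord_succ {α : Type*} {P : α → Prop} (n : ℕ) (ω : ℕ → {a : α // P a}) :
    prefixWord (n + 1) ω = prefixWord n ω ++ [(ω n).1] := by
  unfold prefixWord
  rw [List.ofFn_succ_last]
  rfl

lemma prefixWord_eq_iff {α : Type*} {P : α → Prop} (n : ℕ) (ω ω' : ℕ → {a : α // P a}) :
    prefixWord n ω = prefixWord n ω' ↔ ∀ i < n, ω i = ω' i := by
  simp only [prefixWord, List.ofFn_inj, funext_iff, Subtype.val_inj]
  exact ⟨fun h i hi => h ⟨i, hi⟩, fun h i => h i i.2⟩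

lemma IsQuasiMultiplicative.prefixWord_ne_zero {α : Type*} [Finite α] {p : List α → ℝ} {C : ℝ}
    (hp : IsQuasiMultiplicative p C) (n : ℕ) (ω : ℕ → {a : α // p [a] ≠ 0}) :
    p (prefixWord n ω) ≠ 0 := by
  induction n with
  | zero => simp [prefixWord, hp.nil]
  | succ n ih =>
    rw [prefixWord_succ, Ne, hp.append_eq_zero, not_or]
    exact ⟨ih, (ω n).2⟩

/-- Chosen points of the nested cubes converge geometrically; each approximation depends on finitely
many letters, so the limit is measurable. -/
lemma IsCoding.exists_limit_point (hI : IsCoding I) (hℓ : 2 ≤ ℓ) (P : Fin (ℓ ^ D) → Prop) :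
    ∃ π : (ℕ → {a : Fin (ℓ ^ D) // P a}) → E D, Measurable π ∧
      ∀ ω n, π ω ∈ closure (I (prefixWord n ω)) := by
  choose pt hpt using hI.nonempty hℓ
  have hb : (1 : ℝ) < ℓ := by exact_mod_cast hℓ
  have hanti : ∀ ω : ℕ → {a : Fin (ℓ ^ D) // P a}, Antitone fun n => I (prefixWord n ω) :=
    fun ω => antitone_nat_of_succ_le fun n => by
      rw [prefixWord_succ]; exact hI.append_subset _ _
  have hcauchy : ∀ ω : ℕ → {a : Fin (ℓ ^ D) // P a},
      CauchySeq fun n => pt (prefixWord n ω) := by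
    intro ω
    refine cauchySeq_of_le_geometric (ℓ : ℝ)⁻¹ ((D : ℝ) + 1) (inv_lt_one_of_one_lt₀ hb) fun n => ?_
    have := hI.dist_le_of_mem_closure (subset_closure (hpt (prefixWord n ω)))
      (subset_closure (hanti ω n.le_succ (hpt (prefixWord (n + 1) ω))))
    rwa [length_prefixWord, ← inv_pow] at this
  choose π hπ using fun ω => cauchySeq_tendsto_of_complete (hcauchy ω)
  refine ⟨π, ?_, fun ω n => ?_⟩
  · refine measurable_of_tendsto_metrizable (f := fun n ω => pt (prefixWord n ω)) (fun n => ?_)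
      (tendsto_pi_nhds.2 hπ)
    have hres : Measurable fun (ω : ℕ → {a : Fin (ℓ ^ D) // P a}) (i : Fin n) => ω i :=
      measurable_pi_lambda _ fun i => measurable_pi_apply _
    exact (Measurable.of_discrete
      (f := fun v : Fin n → {a : Fin (ℓ ^ D) // P a} => pt (List.ofFn fun i => (v i).1))).comp hres
  · refine mem_closure_of_tendsto (hπ ω) (eventually_atTop.2 ⟨n, fun k hk => ?_⟩)
    exact hanti ω hk (hpt _)

/-- Only an inequality, because `w` may have the wrong length or use excluded letters. -/
lemma infinitePi_prefixWord_le {α : Type*} [MeasurableSpace α]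
    [MeasurableSingletonClass α] {P : α → Prop}
    [Fintype {a : α // P a}] [Nonempty {a : α // P a}] (n : ℕ) (w : List α) :
    infinitePi (fun _ : ℕ => (PMF.uniformOfFintype {a : α // P a}).toMeasure)
      {ω | prefixWord n ω = w} ≤ ((Fintype.card {a : α // P a} : ℝ≥0∞)⁻¹) ^ n := by
  rcases eq_empty_or_nonempty {ω : ℕ → {a : α // P a} | prefixWord n ω = w} with h | ⟨ω₀, hω₀⟩
  · rw [h, measure_empty]; exact zero_le
  have : {ω : ℕ → {a : α // P a} | prefixWord n ω = w} =
      Set.pi (Finset.range n) fun i => {ω₀ i} := by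
    ext ω
    rw [← (hω₀ : prefixWord n ω₀ = w)]
    simp [prefixWord_eq_iff]
  rw [this, infinitePi_pi _ fun i _ => measurableSet_singleton _]
  have hone : ∀ a : {a : α // P a}, (PMF.uniformOfFintype {a : α // P a}).toMeasure {a} =
      (Fintype.card {a : α // P a} : ℝ≥0∞)⁻¹ := fun a => by
    rw [PMF.toMeasure_apply_singleton _ _ (measurableSet_singleton a), PMF.uniformOfFintype_apply]
  simp only [hone, Finset.prod_const, Finset.card_range, le_refl]

/-- There are exactly `ℓ ^ δ` charged letters, so the uniform Bernoulli measure gives mass at most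
`ℓ ^ (-n δ)` to cylinders of length `n`. All words in these letters are charged, so its image sits
on the support, and the mass distribution principle applies. -/
lemma IsSpectrum.le_dimH_support (hI : IsCoding I) (hℓ : 2 ≤ ℓ)
    {C : ℝ} (hp : IsQuasiMultiplicative (fun w => m.real (I w)) C) {τ : ℝ → ℝ}
    (hs : IsSpectrum (fun w => m.real (I w)) C ℓ τ) {δ : ℝ≥0} (hδ : (δ : ℝ) = τ 0) :
    δ ≤ dimH m.support := by
  classical
  have hb : (1 : ℝ) < ℓ := by exact_mod_cast hℓ
  have hℓ0 : (0 : ℝ) < ℓ := by linarith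
  set β := {a : Fin (ℓ ^ D) // m.real (I [a]) ≠ 0} with hβ
  have hcard : (Fintype.card β : ℝ) = (ℓ : ℝ) ^ (δ : ℝ) := by
    have h1 := hs.powSum_zero hp hb 1
    rw [← card_chargedWords, ← hδ, Nat.cast_one, one_mul] at h1
    rw [← h1, Fintype.card_subtype]
    congr 1
    refine Finset.card_bij (fun a _ => [a]) (fun a ha => ?_) (fun a _ b _ hab => ?_) fun w hw => ?_
    · exact mem_chargedWords.2 ⟨rfl, (Finset.mem_filter.1 ha).2⟩
    · simpa using hab
    · obtain ⟨hlen, hne⟩ := mem_chargedWords.1 hw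
      obtain ⟨a, rfl⟩ := List.length_eq_one_iff.1 hlen
      exact ⟨a, Finset.mem_filter.2 ⟨Finset.mem_univ _, hne⟩, rfl⟩
  have hcard0 : 0 < Fintype.card β := by
    have : (0 : ℝ) < Fintype.card β := hcard ▸ Real.rpow_pos_of_pos hℓ0 _
    exact_mod_cast this
  have : Nonempty β := Fintype.card_pos_iff.1 hcard0
  set μ : Measure (ℕ → β) := infinitePi fun _ : ℕ => (PMF.uniformOfFintype β).toMeasure with hμ
  obtain ⟨π, hπm, hπ⟩ := hI.exists_limit_point hℓ fun a => m.real (I [a]) ≠ 0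
  have hsupp : ∀ ω, π ω ∈ m.support := by
    intro ω
    rw [mem_support_iff_forall]
    intro U hU
    obtain ⟨ε, hε, hball⟩ := Metric.mem_nhds_iff.1 hU
    obtain ⟨n, hn⟩ := ((tendsto_mul_inv_pow hℓ ((D : ℝ) + 1)).eventually_lt_const hε).exists
    have hpos : 0 < m (I (prefixWord n ω)) := by
      have := hp.prefixWord_ne_zero n ω
      exact pos_iff_ne_zero.2 fun h0 => this ((measureReal_eq_zero_iff).2 h0)
    refine hpos.trans_le (measure_mono fun y hy => hball ?_)
    have := hI.dist_le_of_mem_closure (subset_closure hy) (hπ ω n)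
    rw [length_prefixWord] at this
    exact this.trans_lt hn
  have hle : μ.map π ≤ ENNReal.ofReal (5 ^ D * (ℓ : ℝ) ^ (δ : ℝ)) •
      (hausdorffMeasure (δ : ℝ) : Measure (E D)) := by
    refine le_smul_hausdorffMeasure hb δ.2 (by positivity) 0 fun n _ U hU => ?_
    -- `U` is arbitrary; its closure has the same diameter and is measurable, as evaluating the
    -- image measure requires.
    have hU' : ∀ x ∈ closure U, ∀ y ∈ closure U, dist x y ≤ ((ℓ : ℝ) ^ n)⁻¹ := by
      have hd : Metric.ediam (closure U) ≤ ENNReal.ofReal ((ℓ : ℝ) ^ n)⁻¹ := by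
        rw [Metric.ediam_closure]
        refine Metric.ediam_le fun x hx y hy => ?_
        rw [edist_dist]
        exact ENNReal.ofReal_le_ofReal (hU x hx y hy)
      intro x hx y hy
      have := (Metric.edist_le_ediam_of_mem hx hy).trans hd
      rw [edist_dist] at this
      exact (ENNReal.ofReal_le_ofReal_iff (by positivity)).1 this
    set T := (words (Fin (ℓ ^ D)) n).filter fun w => (closure (I w) ∩ closure U).Nonempty with hT
    have hTcard : T.card ≤ 5 ^ D := hI.card_le_of_meets hℓ T
      (fun w hw => mem_words.1 (Finset.mem_filter.1 hw).1) hU'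
      fun w hw => (Finset.mem_filter.1 hw).2
    calc μ.map π U ≤ μ.map π (closure U) := measure_mono subset_closure
      _ = μ (π ⁻¹' closure U) := Measure.map_apply hπm isClosed_closure.measurableSet
      _ ≤ μ (⋃ w ∈ T, {ω | prefixWord n ω = w}) := by
          refine measure_mono fun ω hω => mem_biUnion (Finset.mem_coe.2 (Finset.mem_filter.2
            ⟨mem_words.2 (length_prefixWord n ω), π ω, hπ ω n, hω⟩)) rfl
      _ ≤ ∑ w ∈ T, μ {ω | prefixWord n ω = w} := measure_biUnion_finset_le _ _
      _ ≤ ∑ _w ∈ T, ENNReal.ofReal ((ℓ : ℝ) ^ (-(n * (δ : ℝ)))) := by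
          refine Finset.sum_le_sum fun w _ => (infinitePi_prefixWord_le n w).trans (le_of_eq ?_)
          have e : (Fintype.card β : ℝ≥0∞) = ENNReal.ofReal ((ℓ : ℝ) ^ (δ : ℝ)) := by
            rw [← hcard, ENNReal.ofReal_natCast]
          have e' : (ℓ : ℝ) ^ (-(n * (δ : ℝ))) = (((ℓ : ℝ) ^ (δ : ℝ))⁻¹) ^ n := by
            rw [← Real.rpow_neg hℓ0.le, ← Real.rpow_natCast, ← Real.rpow_mul hℓ0.le]
            ring_nf
          rw [e', ENNReal.ofReal_pow (by positivity),
            ENNReal.ofReal_inv_of_pos (Real.rpow_pos_of_pos hℓ0 _), ← e]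
      _ = ENNReal.ofReal (T.card * (ℓ : ℝ) ^ (-(n * (δ : ℝ)))) := by
          rw [Finset.sum_const, nsmul_eq_mul, ← ENNReal.ofReal_natCast,
            ← ENNReal.ofReal_mul (by positivity)]
      _ ≤ _ := by
          refine ENNReal.ofReal_le_ofReal (mul_le_mul_of_nonneg_right ?_ (by positivity))
          exact_mod_cast hTcard
  refine le_dimH_of_hausdorffMeasure_ne_zero fun h0 => ?_
  have h1 := hle m.support
  rw [Measure.smul_apply, h0, smul_zero, Measure.map_apply hπm isClosed_support.measurableSet,
    eq_univ_of_forall (s := π ⁻¹' m.support) hsupp, measure_univ] at h1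
  exact absurd h1 (by simp)

/-! ### The monofractal case -/

/-- One bound is the mass distribution principle. For the other, an open `U` is treated by covering
its part of the support with charged closed cubes inside `U`, whose half-open versions are disjoint;
outer regularity reaches all sets. -/
theorem IsCoding.stronglyEquivalent_hausdorffMeasure (hI : IsCoding I) (hℓ : 2 ≤ ℓ)
    (hcube : m (unitCube D) = 1) {C δ : ℝ} (hC : 0 < C) (hδ : 0 ≤ δ)
    (hup : ∀ w, m.real (I w) ≤ C * (ℓ : ℝ) ^ (-(w.length * δ)))
    (hlow : ∀ w, m.real (I w) ≠ 0 → (ℓ : ℝ) ^ (-(w.length * δ)) ≤ C * m.real (I w)) :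
    StronglyEquivalent m ((hausdorffMeasure δ).restrict m.support) := by
  classical
  have hb : (1 : ℝ) < ℓ := by exact_mod_cast hℓ
  have hℓ0 : (0 : ℝ) < ℓ := by linarith
  have h1 : m ≤ ENNReal.ofReal (5 ^ D * C * (ℓ : ℝ) ^ δ) •
      (hausdorffMeasure δ : Measure (E D)) := by
    refine le_smul_hausdorffMeasure hb hδ (by positivity) 0 fun n _ U hU => ?_
    rw [mul_assoc]
    refine hI.measure_le_of_forall_le hℓ hcube hU (by positivity) fun w hw _ => ?_
    rw [← mem_words.1 hw]
    exact hup w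
  have hopen : ∀ U : Set (E D), IsOpen U → hausdorffMeasure δ (U ∩ m.support) ≤
      ENNReal.ofReal (((D : ℝ) + 1) ^ δ * C) * m U := by
    intro U hU
    -- For a point of `S n`, every closed cube of generation at least `n` containing it lies in `U`.
    set S : ℕ → Set (E D) := fun n => {x | x ∈ m.support ∧
      Metric.closedBall x (((D : ℝ) + 1) * ((ℓ : ℝ) ^ n)⁻¹) ⊆ U} with hS
    have hScov : U ∩ m.support ⊆ ⋃ n, S n := by
      rintro x ⟨hxU, hxs⟩
      obtain ⟨ε, hε, hball⟩ := Metric.isOpen_iff.1 hU x hxU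
      obtain ⟨n, hn⟩ := ((tendsto_mul_inv_pow hℓ ((D : ℝ) + 1)).eventually_lt_const hε).exists
      exact mem_iUnion.2 ⟨n, hxs, (Metric.closedBall_subset_ball hn).trans hball⟩
    have hmul : ∀ n k, n ≤ k → ((D : ℝ) + 1) * ((ℓ : ℝ) ^ k)⁻¹ ≤ ((D : ℝ) + 1) * ((ℓ : ℝ) ^ n)⁻¹ :=
      fun n k hnk => by
        have := hb.le
        gcongr
    have hSmono : Monotone S := fun n k hnk x hx =>
      ⟨hx.1, (Metric.closedBall_subset_closedBall (hmul n k hnk)).trans hx.2⟩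
    refine (measure_mono hScov).trans ?_
    rw [hSmono.measure_iUnion]
    refine iSup_le fun n => ?_
    rw [← ofReal_measureReal (μ := m) (s := U), ← ENNReal.ofReal_mul (by positivity), mul_assoc]
    refine hI.hausdorffMeasure_le_of_cover hℓ hδ
      (T := fun k => (chargedWords I m k).filter fun w => closure (I w) ⊆ U)
      (fun k w hw => (mem_chargedWords.1 (Finset.mem_filter.1 hw).1).1)
      (eventually_atTop.2 ⟨n, fun k hk x hx => ?_⟩) fun k => ?_
    · obtain ⟨w, hw, hxw⟩ := hI.exists_mem_closure_of_mem_support hℓ hcube hx.1 k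
      refine mem_biUnion (Finset.mem_coe.2 (Finset.mem_filter.2 ⟨hw, fun y hy => hx.2 ?_⟩)) hxw
      have := hI.dist_le_of_mem_closure hy hxw
      rw [(mem_chargedWords.1 hw).1] at this
      exact this.trans (hmul n k hk)
    · have hlen : ∀ w ∈ (chargedWords I m k).filter fun w => closure (I w) ⊆ U, w.length = k :=
        fun w hw => (mem_chargedWords.1 (Finset.mem_filter.1 hw).1).1
      calc _ = ∑ w ∈ (chargedWords I m k).filter fun w => closure (I w) ⊆ U,
            (ℓ : ℝ) ^ (-(k * δ)) := by rw [Finset.sum_const, nsmul_eq_mul]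
        _ ≤ ∑ w ∈ (chargedWords I m k).filter fun w => closure (I w) ⊆ U, C * m.real (I w) := by
            refine Finset.sum_le_sum fun w hw => ?_
            have := hlow w (mem_chargedWords.1 (Finset.mem_filter.1 hw).1).2
            rwa [hlen w hw] at this
        _ = C * m.real (⋃ w ∈ (chargedWords I m k).filter fun w => closure (I w) ⊆ U, I w) := by
            rw [← Finset.mul_sum, hI.measureReal_biUnion hℓ m hlen]
        _ ≤ C * m.real U := by
            refine mul_le_mul_of_nonneg_left (measureReal_mono ?_) hC.le
            exact iUnion₂_subset fun w hw => subset_closure.trans (Finset.mem_filter.1 hw).2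
  set K₁ := ENNReal.ofReal (5 ^ D * C * (ℓ : ℝ) ^ δ) with hK₁
  set K₂ := ENNReal.ofReal (((D : ℝ) + 1) ^ δ * C) with hK₂
  have hK₂0 : K₂ ≠ 0 := by
    rw [hK₂, Ne, ENNReal.ofReal_eq_zero, not_le]; positivity
  have h2 : ∀ A : Set (E D), hausdorffMeasure δ (A ∩ m.support) ≤ K₂ * m A := by
    intro A
    rw [mul_comm, ← ENNReal.div_le_iff_le_mul (Or.inl hK₂0) (Or.inl ENNReal.ofReal_ne_top),
      A.measure_eq_iInf_isOpen m]
    refine le_iInf₂ fun U hAU => le_iInf fun hU => ?_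
    rw [ENNReal.div_le_iff_le_mul (Or.inl hK₂0) (Or.inl ENNReal.ofReal_ne_top), mul_comm]
    exact (measure_mono (inter_subset_inter_left _ hAU)).trans (hopen U hU)
  refine ⟨max 1 (max K₁.toNNReal K₂.toNNReal), le_max_left _ _, fun A hA => ?_⟩
  set M : ℝ≥0 := max 1 (max K₁.toNNReal K₂.toNNReal) with hM
  have hM0 : (M : ℝ≥0∞) ≠ 0 := by
    have : 1 ≤ M := le_max_left _ _
    exact_mod_cast (zero_lt_one.trans_le this).ne'
  have hM1 : K₁ ≤ M := by
    rw [← ENNReal.coe_toNNReal (show K₁ ≠ ∞ from ENNReal.ofReal_ne_top)]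
    exact_mod_cast (le_max_left _ _).trans (le_max_right _ _)
  have hM2 : K₂ ≤ M := by
    rw [← ENNReal.coe_toNNReal (show K₂ ≠ ∞ from ENNReal.ofReal_ne_top)]
    exact_mod_cast (le_max_right _ _).trans (le_max_right _ _)
  rw [Measure.restrict_apply hA]
  constructor
  · rw [mul_comm, ← div_eq_mul_inv, ENNReal.div_le_iff_le_mul (Or.inl hM0)
      (Or.inl ENNReal.coe_ne_top), mul_comm]
    exact (h2 A).trans (by gcongr)
  · calc m A ≤ m (A ∩ m.support) + m m.supportᶜ := by
          refine (measure_mono fun x hx => ?_).trans (measure_union_le _ _)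
          by_cases hxs : x ∈ m.support
          · exact Or.inl ⟨hx, hxs⟩
          · exact Or.inr hxs
      _ = m (A ∩ m.support) := by rw [measure_compl_support, add_zero]
      _ ≤ K₁ * hausdorffMeasure δ (A ∩ m.support) := h1 _
      _ ≤ M * hausdorffMeasure δ (A ∩ m.support) := by gcongr

end Support

end QB

end

/-! ### The dichotomy, with `d = -τ'(1)` and `δ = τ(0)`. -/

theorem mainTheorem12 (D ℓ : ℕ) (hℓ : 2 ≤ ℓ)
    (I : List (Fin (ℓ ^ D)) → Set (QB.E D)) (hI : QB.IsCoding I)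
    (m : MeasureTheory.Measure (QB.E D)) (hm : QB.IsQuasiBernoulli I m)
    (hτ : AnalyticOnNhd ℝ (QB.lqSpectrum ℓ m) Set.univ) :
    ∃ d δ : NNReal, QB.HasDim m d ∧ dimH m.support = δ ∧
      ((d = δ ∧ QB.StronglyEquivalent m
          ((MeasureTheory.Measure.hausdorffMeasure (δ : ℝ)).restrict m.support)) ∨
        (d < δ ∧
          MeasureTheory.Measure.MutuallySingular m
            (MeasureTheory.Measure.hausdorffMeasure (d : ℝ)) ∧
          MeasureTheory.Measure.AbsolutelyContinuous m (QB.packingMeasure (d : ℝ)))) := by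
  have := hm.isProbabilityMeasure
  have hcube := hm.measure_unitCube
  have hb : (1 : ℝ) < ℓ := by exact_mod_cast hℓ
  obtain ⟨C, hp⟩ := hm.exists_isQuasiMultiplicative hI hℓ
  have hs := hI.isSpectrum hℓ hp
  set τ := QB.lqSpectrum ℓ m with hτdef
  have hder : HasDerivAt τ (-(-deriv τ 1)) 1 := by
    rw [neg_neg]
    exact (hτ 1 (Set.mem_univ _)).differentiableAt.hasDerivAt
  have hd0 := hs.neg_deriv_nonneg hp hb hder
  have hdle := hs.neg_deriv_le hp hb hder
  obtain ⟨d, hd⟩ : ∃ d : NNReal, (d : ℝ) = -deriv τ 1 := ⟨⟨_, hd0⟩, rfl⟩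
  obtain ⟨δ, hδ⟩ : ∃ δ : NNReal, (δ : ℝ) = τ 0 := ⟨⟨_, hd0.trans hdle⟩, rfl⟩
  rw [← hd] at hder hdle
  refine ⟨d, δ, hs.hasDim hI hℓ hcube hp hder,
    le_antisymm (hs.dimH_support_le hI hℓ hcube hp hδ) (hs.le_dimH_support hI hℓ hp hδ), ?_⟩
  rcases hdle.eq_or_lt with heq | hlt
  · left
    have hdδ : d = δ := NNReal.coe_injective (heq.trans hδ.symm)
    subst hdδ
    have haff := hs.affine_of_eq hp hb hτ hder heq
    exact ⟨rfl, hI.stronglyEquivalent_hausdorffMeasure hℓ hcube hp.C_pos d.2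
      (hs.le_of_affine hp hb haff) (hs.ge_of_affine hp hb haff)⟩
  · right
    refine ⟨?_, ?_, ?_⟩
    · rw [← NNReal.coe_lt_coe, hδ]
      exact hlt
    · exact hI.mutuallySingular_hausdorffMeasure hℓ hcube hp d.2
        (hs.exists_fluctuation_above hp hb hτ hder hlt)
    · exact hI.absolutelyContinuous_packingMeasure hℓ hcube hp
        (hs.exists_fluctuation_below hp hb hτ hder hlt)
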